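/- Let $p$ be a prime and let $S$ be a finite $p$-group. **Bisets.** For finite groups $G,H$, let $B(G,H)$ be the Grothendieck group (with respect to disjoint unions) of finite $(G,H)$-bisets, i.e. finite sets with commuting left $G$-action and right $H$-action, and let $\mathbb{Q}B(G,H)=\mathbb{Q}\otimes_{\mathbb{Z}}B(G,H)$. Let $\cdot_H\colon \mathbb{Q}B(G,H)\times\mathbb{Q}B(H,K)\to\mathbb{Q}B(G,K)$ be the bilinear map with $[X]\cdot_H[Y]=[X\times_H Y]$, and for $L\le G\times H$ let $\Phi_L\colon\mathbb{Q}B(G,H)\to\mathbb{Q}$ be the linear map with $\Phi_L([X])=|X^L|$, where $X^L=\{x\in X\mid gxh^{-1}=x \text{ for all } (g,h)\in L\}$. For an injective homomorphism $\phi\colon P\to G$ with $P\le H$ put $\Delta(\phi(P),\phi,P)=\{(\phi(u),u)\mid u\in P\}\le G\times H$; let $\Delta_{G,H}$ be the set of all these subgroups, and $\mathbb{Q}B^\Delta(G,H)$ the span of the elements $[(G\times H)/L]$ with $L\in\Delta_{G,H}$. Put $\Delta(S)=\{(s,s)\mid s\in S\}$, and let $p_1\colon S\times S\to S$ be the first projection.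 An element $a\in\mathbb{Q}B^\Delta(S,S)$ is a *Frobenius element* if $a\times a=(a\times[S])\cdot_S a$ in $\mathbb{Q}B(S\times S,S)$ and $a\times a=a\cdot_S(a\times[S])$ in $\mathbb{Q}B(S,S\times S)$. Here $\times$ is induced by the cartesian product of bisets, restricted along the diagonal $S\to S\times S$ on the right in the first equation and on the left in the second one. Put $\mathrm{Fix}(a)=\{L\in\Delta_{S,S}\mid\Phi_L(a)\ne0\}$. Let $\mathrm{Idem}(S)$ be the set of idempotents $\omega\in\mathbb{Q}B^\Delta(S,S)$ (that is, $\omega\cdot_S\omega=\omega$) that are Frobenius elements and for which $\mathrm{Fix}(\omega)$ is closed under taking subgroups and contains $\Delta(S)$. **Fusion systems.** A *fusion system* on $S$ is a category $\mathcal F$ whose objects are the subgroups of $S$, whose morphisms $P\to Q$ are injective group homomorphisms, with the usual composition, such that all homomorphisms $P\to Q$ induced by conjugation with an element of $S$ are morphisms, and such that for every morphism $\phi\colon P\to Q$ the isomorphism $P\to\phi(P)$ and its inverse are morphisms. Let $\mathrm{Fus}(S)$ be the set of fusion systems on $S$, and put $\mathcal S(\mathcal F)=\{\Delta(\phi(P),\phi,P)\mid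 P\le S,\ \phi\in\mathrm{Hom}_{\mathcal F}(P,S)\}$. Let $\mathrm{Sys}(S)$ be the set of all subsets of $\Delta_{S,S}$ that contain $\Delta(S)$ and are closed under $S\times S$-conjugation, under taking subgroups, under $L*M=\{(g,k)\mid \exists h\in S\colon (g,h)\in L,\ (h,k)\in M\}$ and under $L\mapsto L^\circ=\{(h,g)\mid(g,h)\in L\}$. **Theorem.** For every fusion system $\mathcal F$ on $S$ there is a unique element $\omega_{\mathcal F}\in\mathbb{Q}B^\Delta(S,S)$ such that, for all $L\le S\times S$, $$\Phi_L(\omega_{\mathcal F})=\begin{cases}\dfrac{|S|}{|\mathrm{Hom}_{\mathcal F}(p_1(L),S)|}&\text{if }L\in\mathcal S(\mathcal F),\\[1ex]0&\text{otherwise.}\end{cases}$$ One has $\omega_{\mathcal F}\in\mathrm{Idem}(S)$, $\mathcal S(\mathcal F)\in\mathrm{Sys}(S)$, and $\mathrm{Fix}(\omega)\in\mathrm{Sys}(S)$ for every $\omega\in\mathrm{Idem}(S)$. The maps $$f\colon\mathrm{Fus}(S)\to\mathrm{Idem}(S),\ \mathcal F\mapsto\omega_{\mathcal F},\qquad g\colon\mathrm{Idem}(S)\to\mathrm{Sys}(S),\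 \omega\mapsto\mathrm{Fix}(\omega),\qquad h\colon\mathrm{Fus}(S)\to\mathrm{Sys}(S),\ \mathcal F\mapsto\mathcal S(\mathcal F)$$ are bijections, and $g\circ f=h$, i.e. $\mathrm{Fix}(\omega_{\mathcal F})=\mathcal S(\mathcal F)$ for every $\mathcal F$. Moreover, for $\mathcal F\in\mathrm{Fus}(S)$ and $\omega\in\mathrm{Idem}(S)$, one has $\omega_{\mathcal F}=\omega$ if and only if $\mathcal S(\mathcal F)=\mathrm{Fix}(\omega)$. -/

import Mathlib

universe u

open scoped TensorProduct

noncomputable section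

namespace DoubleBurnside

/-! ### Bisets -/

/-- A `(G, H)`-biset: a finite set with commuting left `G`-action and right `H`-action.
The right action is written `x h = MulOpposite.op h • x`. -/
structure Biset (G H : Type u) [Group G] [Group H] : Type (u + 1) where
  carrier : Type u
  [finite : Finite carrier]
  [left : MulAction G carrier]
  [right : MulAction Hᵐᵒᵖ carrier]
  [comm : SMulCommClass G Hᵐᵒᵖ carrier]

attribute [instance] Biset.finite Biset.left Biset.right Biset.comm

namespace Biset

section

variable {G H K G' H' : Type u} [Group G] [Group H] [Group K] [Group G'] [Group H']

/-- Isomorphism of bisets: there is a bijection that commutes with both actions. -/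
def Iso (X Y : Biset G H) : Prop :=
  ∃ e : X.carrier ≃ Y.carrier,
    (∀ (g : G) (x : X.carrier), e (g • x) = g • e x) ∧
    (∀ (h : H) (x : X.carrier), e (MulOpposite.op h • x) = MulOpposite.op h • e x)

instance isoSetoid (G H : Type u) [Group G] [Group H] : Setoid (Biset G H) where
  r := Iso
  iseqv :=
    { refl := fun X => ⟨Equiv.refl _, fun _ _ => rfl, fun _ _ => rfl⟩
      symm := by
        rintro X Y ⟨e, h1, h2⟩
        refine ⟨e.symm, fun g y => ?_, fun h y => ?_⟩
        · rw [Equiv.symm_apply_eq, h1, Equiv.apply_symm_apply]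
        · rw [Equiv.symm_apply_eq, h2, Equiv.apply_symm_apply]
      trans := by
        rintro X Y Z ⟨e, h1, h2⟩ ⟨f, k1, k2⟩
        exact ⟨e.trans f, fun g x => by simp [h1, k1], fun h x => by simp [h2, k2]⟩ }

/-- Build a biset from its left action `l g x = g x` and its right action `r h x = x h`. -/
def ofMaps (C : Type u) [Finite C] (l : G → C → C) (r : H → C → C)
    (one_l : ∀ x, l 1 x = x) (mul_l : ∀ g g' x, l (g * g') x = l g (l g' x))
    (one_r : ∀ x, r 1 x = x) (mul_r : ∀ h h' x, r (h * h') x = r h' (r h x))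
    (comm : ∀ g h x, l g (r h x) = r h (l g x)) : Biset G H :=
  letI _i1 : MulAction G C := { smul := l, one_smul := one_l, mul_smul := mul_l }
  letI _i2 : MulAction Hᵐᵒᵖ C :=
    { smul := fun h => r h.unop
      one_smul := one_r
      mul_smul := fun h h' x => mul_r h'.unop h.unop x }
  letI _i3 : SMulCommClass G Hᵐᵒᵖ C := ⟨fun g h x => comm g h.unop x⟩
  { carrier := C }

/-- The empty biset. -/
def empty (G H : Type u) [Group G] [Group H] : Biset G H :=
  ofMaps PEmpty (fun _ x => x) (fun _ x => x) (fun _ => rfl) (fun _ _ _ => rfl)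
    (fun _ => rfl) (fun _ _ _ => rfl) (fun _ _ _ => rfl)

/-- The disjoint union of two bisets. -/
def sum (X Y : Biset G H) : Biset G H where
  carrier := X.carrier ⊕ Y.carrier

/-- The `H`-orbit relation on `X × Y` for the action `h (x, y) = (x h⁻¹, h y)`. -/
def tensorSetoid (X : Biset G H) (Y : Biset H K) : Setoid (X.carrier × Y.carrier) where
  r a b := ∃ h : H, b = (MulOpposite.op h⁻¹ • a.1, h • a.2)
  iseqv :=
    { refl := fun a => ⟨1, by simp⟩
      symm := by
        rintro a b ⟨h, rfl⟩
        exact ⟨h⁻¹, by simp⟩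
      trans := by
        rintro a b c ⟨h, rfl⟩ ⟨k, rfl⟩
        exact ⟨k * h, by simp [mul_smul]⟩ }

/-- The tensor product `X ×_H Y`, the set of `H`-orbits on `X × Y` with
`g (x ×_H y) k = g x ×_H y k`. -/
def tensor (X : Biset G H) (Y : Biset H K) : Biset G K :=
  ofMaps (Quotient (tensorSetoid X Y))
    (fun g => Quotient.map (sa := tensorSetoid X Y) (sb := tensorSetoid X Y)
      (fun a => (g • a.1, a.2)) (by
        rintro a b ⟨h, rfl⟩
        exact ⟨h, by simp [smul_comm]⟩))
    (fun k => Quotient.map (sa := tensorSetoid X Y) (sb := tensorSetoid X Y)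
      (fun a => (a.1, MulOpposite.op k • a.2)) (by
        rintro a b ⟨h, rfl⟩
        exact ⟨h, by simp [smul_comm]⟩))
    (by
      rintro ⟨a⟩
      exact congrArg (Quotient.mk (tensorSetoid X Y)) (by simp))
    (by
      rintro g g' ⟨a⟩
      exact congrArg (Quotient.mk (tensorSetoid X Y)) (by simp [mul_smul]))
    (by
      rintro ⟨a⟩
      exact congrArg (Quotient.mk (tensorSetoid X Y)) (by simp))
    (by
      rintro k k' ⟨a⟩
      exact congrArg (Quotient.mk (tensorSetoid X Y)) (by simp [mul_smul]))
    (by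
      rintro g k ⟨a⟩
      rfl)

/-- The external product `X × Y`, a `(G × G', H × H')`-biset, with
`(g, g') (x, y) (h, h') = (g x h, g' y h')`. -/
def ext (X : Biset G H) (Y : Biset G' H') : Biset (G × G') (H × H') :=
  ofMaps (X.carrier × Y.carrier)
    (fun g a => (g.1 • a.1, g.2 • a.2))
    (fun h a => (MulOpposite.op h.1 • a.1, MulOpposite.op h.2 • a.2))
    (fun a => by simp)
    (fun g g' a => by simp [mul_smul])
    (fun a => by simp)
    (fun h h' a => by simp [mul_smul])
    (fun g h a => by simp [smul_comm])

/-- Restriction of a biset along group homomorphisms `α` (left) and `β` (right). -/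
def res (α : G' →* G) (β : H' →* H) (X : Biset G H) : Biset G' H' :=
  ofMaps X.carrier
    (fun g x => α g • x)
    (fun h x => MulOpposite.op (β h) • x)
    (fun x => by simp)
    (fun g g' x => by simp [mul_smul])
    (fun x => by simp)
    (fun h h' x => by simp [mul_smul])
    (fun g h x => smul_comm (α g) (MulOpposite.op (β h)) x)

/-- The group `G` as a `(G, G)`-biset by left and right multiplication. -/
def regular (G : Type u) [Group G] [Finite G] : Biset G G where
  carrier := G

/-- The transitive biset `(G × H) / L`, with `g x h = (g, h⁻¹) x`. -/
def coset [Finite G] [Finite H] (L : Subgroup (G × H)) : Biset G H :=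
  ofMaps ((G × H) ⧸ L)
    (fun g x => ((g, 1) : G × H) • x)
    (fun h x => ((1, h⁻¹) : G × H) • x)
    (fun x => one_smul (G × H) x)
    (fun g g' x => by simp [smul_smul])
    (fun x => by
      rw [inv_one]
      exact one_smul (G × H) x)
    (fun h h' x => by simp [smul_smul])
    (fun g h x => by simp [smul_smul])

/-- The `L`-fixed points of a biset: the `x` with `g x h⁻¹ = x` for all `(g, h) ∈ L`. -/
def fixedPoints (L : Subgroup (G × H)) (X : Biset G H) : Set X.carrier :=
  {x | ∀ a ∈ L, a.1 • MulOpposite.op a.2⁻¹ • x = x}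

end

section

variable {G H K G' H' : Type u} [Group G] [Group H] [Group K] [Group G'] [Group H']

theorem sum_congr {X X' Y Y' : Biset G H} (hX : X ≈ X') (hY : Y ≈ Y') :
    X.sum Y ≈ X'.sum Y' := by
  obtain ⟨e, h1, h2⟩ := hX
  obtain ⟨f, k1, k2⟩ := hY
  refine ⟨Equiv.sumCongr e f, ?_, ?_⟩
  · rintro g (x | x)
    · exact congrArg Sum.inl (h1 g x)
    · exact congrArg Sum.inr (k1 g x)
  · rintro g (x | x)
    · exact congrArg Sum.inl (h2 g x)
    · exact congrArg Sum.inr (k2 g x)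

theorem sum_comm (X Y : Biset G H) : X.sum Y ≈ Y.sum X := by
  refine ⟨Equiv.sumComm _ _, ?_, ?_⟩ <;> rintro g (x | x) <;> rfl

theorem sum_assoc (X Y Z : Biset G H) : (X.sum Y).sum Z ≈ X.sum (Y.sum Z) := by
  refine ⟨Equiv.sumAssoc _ _ _, ?_, ?_⟩ <;> rintro g ((x | x) | x) <;> rfl

theorem empty_sum (X : Biset G H) : (empty G H).sum X ≈ X := by
  refine ⟨Equiv.emptySum PEmpty X.carrier, ?_, ?_⟩ <;> rintro g (x | x)
  · exact x.elim
  · rfl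
  · exact x.elim
  · rfl

theorem tensor_congr {X X' : Biset G H} {Y Y' : Biset H K} (hX : X ≈ X') (hY : Y ≈ Y') :
    X.tensor Y ≈ X'.tensor Y' := by
  obtain ⟨e, h1, h2⟩ := hX
  obtain ⟨f, k1, k2⟩ := hY
  refine ⟨Quotient.congr (ra := tensorSetoid X Y) (rb := tensorSetoid X' Y')
    (Equiv.prodCongr e f) ?_, ?_, ?_⟩
  · rintro ⟨x, y⟩ ⟨x', y'⟩
    refine exists_congr fun h => ?_
    simp only [Equiv.prodCongr_apply, Prod.map_apply, Prod.mk.injEq, ← h2, ← k1,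
      EmbeddingLike.apply_eq_iff_eq]
  · rintro g ⟨x, y⟩
    exact congrArg (Quotient.mk (tensorSetoid X' Y')) (Prod.ext (h1 g x) rfl)
  · rintro k ⟨x, y⟩
    exact congrArg (Quotient.mk (tensorSetoid X' Y')) (Prod.ext rfl (k2 k y))

theorem sum_tensor (X X' : Biset G H) (Y : Biset H K) :
    (X.sum X').tensor Y ≈ (X.tensor Y).sum (X'.tensor Y) := by
  refine ⟨⟨Quotient.lift (s := tensorSetoid (X.sum X') Y)
      (fun a => match a with
        | (Sum.inl x, y) => Sum.inl (Quotient.mk (tensorSetoid X Y) (x, y))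
        | (Sum.inr x, y) => Sum.inr (Quotient.mk (tensorSetoid X' Y) (x, y))) ?_,
      Sum.elim
        (Quotient.map (sa := tensorSetoid X Y) (sb := tensorSetoid (X.sum X') Y)
          (fun a => (Sum.inl a.1, a.2)) ?_)
        (Quotient.map (sa := tensorSetoid X' Y) (sb := tensorSetoid (X.sum X') Y)
          (fun a => (Sum.inr a.1, a.2)) ?_), ?_, ?_⟩, ?_, ?_⟩
  · rintro ⟨x | x, y⟩ b ⟨h, rfl⟩
    · exact congrArg Sum.inl (Quotient.sound (s := tensorSetoid X Y) ⟨h, rfl⟩)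
    · exact congrArg Sum.inr (Quotient.sound (s := tensorSetoid X' Y) ⟨h, rfl⟩)
  · rintro a b ⟨h, rfl⟩
    exact ⟨h, rfl⟩
  · rintro a b ⟨h, rfl⟩
    exact ⟨h, rfl⟩
  · rintro ⟨x | x, y⟩ <;> rfl
  · rintro (⟨x, y⟩ | ⟨x, y⟩) <;> rfl
  · rintro g ⟨x | x, y⟩ <;> rfl
  · rintro g ⟨x | x, y⟩ <;> rfl

theorem tensor_sum (X : Biset G H) (Y Y' : Biset H K) :
    X.tensor (Y.sum Y') ≈ (X.tensor Y).sum (X.tensor Y') := by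
  refine ⟨⟨Quotient.lift (s := tensorSetoid X (Y.sum Y'))
      (fun a => match a with
        | (x, Sum.inl y) => Sum.inl (Quotient.mk (tensorSetoid X Y) (x, y))
        | (x, Sum.inr y) => Sum.inr (Quotient.mk (tensorSetoid X Y') (x, y))) ?_,
      Sum.elim
        (Quotient.map (sa := tensorSetoid X Y) (sb := tensorSetoid X (Y.sum Y'))
          (fun a => (a.1, Sum.inl a.2)) ?_)
        (Quotient.map (sa := tensorSetoid X Y') (sb := tensorSetoid X (Y.sum Y'))
          (fun a => (a.1, Sum.inr a.2)) ?_), ?_, ?_⟩, ?_, ?_⟩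
  · rintro ⟨x, y | y⟩ b ⟨h, rfl⟩
    · exact congrArg Sum.inl (Quotient.sound (s := tensorSetoid X Y) ⟨h, rfl⟩)
    · exact congrArg Sum.inr (Quotient.sound (s := tensorSetoid X Y') ⟨h, rfl⟩)
  · rintro a b ⟨h, rfl⟩
    exact ⟨h, rfl⟩
  · rintro a b ⟨h, rfl⟩
    exact ⟨h, rfl⟩
  · rintro ⟨x, y | y⟩ <;> rfl
  · rintro (⟨x, y⟩ | ⟨x, y⟩) <;> rfl
  · rintro g ⟨x, y | y⟩ <;> rfl
  · rintro g ⟨x, y | y⟩ <;> rfl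

theorem empty_tensor (Y : Biset H K) : (empty G H).tensor Y ≈ empty G K := by
  have : IsEmpty ((empty G H).tensor Y).carrier := ⟨by rintro ⟨x, _⟩; exact x.elim⟩
  have : IsEmpty (empty G K).carrier := inferInstanceAs (IsEmpty PEmpty)
  exact ⟨Equiv.equivOfIsEmpty _ _, fun _ x => isEmptyElim x, fun _ x => isEmptyElim x⟩

theorem tensor_empty (X : Biset G H) : X.tensor (empty H K) ≈ empty G K := by
  have : IsEmpty (X.tensor (empty H K)).carrier := ⟨by rintro ⟨_, x⟩; exact x.elim⟩
  have : IsEmpty (empty G K).carrier := inferInstanceAs (IsEmpty PEmpty)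
  exact ⟨Equiv.equivOfIsEmpty _ _, fun _ x => isEmptyElim x, fun _ x => isEmptyElim x⟩

theorem ext_congr {X X' : Biset G H} {Y Y' : Biset G' H'} (hX : X ≈ X') (hY : Y ≈ Y') :
    X.ext Y ≈ X'.ext Y' := by
  obtain ⟨e, h1, h2⟩ := hX
  obtain ⟨f, k1, k2⟩ := hY
  exact ⟨Equiv.prodCongr e f, fun g a => Prod.ext (h1 g.1 a.1) (k1 g.2 a.2),
    fun h a => Prod.ext (h2 h.1 a.1) (k2 h.2 a.2)⟩

theorem sum_ext (X X' : Biset G H) (Y : Biset G' H') :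
    (X.sum X').ext Y ≈ (X.ext Y).sum (X'.ext Y) := by
  refine ⟨Equiv.sumProdDistrib _ _ _, ?_, ?_⟩ <;> rintro g ⟨x | x, y⟩ <;> rfl

theorem ext_sum (X : Biset G H) (Y Y' : Biset G' H') :
    X.ext (Y.sum Y') ≈ (X.ext Y).sum (X.ext Y') := by
  refine ⟨Equiv.prodSumDistrib _ _ _, ?_, ?_⟩ <;> rintro g ⟨x, y | y⟩ <;> rfl

theorem empty_ext (Y : Biset G' H') : (empty G H).ext Y ≈ empty (G × G') (H × H') := by
  have : IsEmpty ((empty G H).ext Y).carrier := ⟨by rintro ⟨x, _⟩; exact x.elim⟩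
  have : IsEmpty (empty (G × G') (H × H')).carrier := inferInstanceAs (IsEmpty PEmpty)
  exact ⟨Equiv.equivOfIsEmpty _ _, fun _ x => isEmptyElim x, fun _ x => isEmptyElim x⟩

theorem ext_empty (X : Biset G H) : X.ext (empty G' H') ≈ empty (G × G') (H × H') := by
  have : IsEmpty (X.ext (empty G' H')).carrier := ⟨by rintro ⟨_, x⟩; exact x.elim⟩
  have : IsEmpty (empty (G × G') (H × H')).carrier := inferInstanceAs (IsEmpty PEmpty)
  exact ⟨Equiv.equivOfIsEmpty _ _, fun _ x => isEmptyElim x, fun _ x => isEmptyElim x⟩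

theorem res_congr (α : G' →* G) (β : H' →* H) {X Y : Biset G H} (h : X ≈ Y) :
    X.res α β ≈ Y.res α β := by
  obtain ⟨e, h1, h2⟩ := h
  exact ⟨e, fun g x => h1 (α g) x, fun k x => h2 (β k) x⟩

theorem res_sum (α : G' →* G) (β : H' →* H) (X Y : Biset G H) :
    (X.sum Y).res α β ≈ (X.res α β).sum (Y.res α β) := by
  refine ⟨Equiv.refl _, ?_, ?_⟩ <;> rintro g (x | x) <;> rfl

theorem res_empty (α : G' →* G) (β : H' →* H) : (empty G H).res α β ≈ empty G' H' :=
  ⟨Equiv.refl _, fun _ _ => rfl, fun _ _ => rfl⟩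

theorem card_fixedPoints_congr (L : Subgroup (G × H)) {X Y : Biset G H} (h : X ≈ Y) :
    Nat.card (fixedPoints L X) = Nat.card (fixedPoints L Y) := by
  obtain ⟨e, h1, h2⟩ := h
  refine Nat.card_congr (Equiv.subtypeEquiv e fun x => ?_)
  refine forall_congr' fun a => forall_congr' fun _ => ?_
  rw [← h2, ← h1, EmbeddingLike.apply_eq_iff_eq]

theorem card_fixedPoints_sum (L : Subgroup (G × H)) (X Y : Biset G H) :
    Nat.card (fixedPoints L (X.sum Y)) =
      Nat.card (fixedPoints L X) + Nat.card (fixedPoints L Y) := by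
  rw [← Nat.card_sum]
  refine Nat.card_congr
    ((Equiv.subtypeSum (p := fun x => x ∈ fixedPoints L (X.sum Y))).trans
      (Equiv.sumCongr (Equiv.subtypeEquivRight fun x => ?_)
        (Equiv.subtypeEquivRight fun x => ?_)))
  · exact forall_congr' fun a => forall_congr' fun _ => Sum.inl_injective.eq_iff
  · exact forall_congr' fun a => forall_congr' fun _ => Sum.inr_injective.eq_iff

theorem card_fixedPoints_empty (L : Subgroup (G × H)) :
    Nat.card (fixedPoints L (empty G H)) = 0 := by
  have : IsEmpty (fixedPoints L (empty G H)) := ⟨fun x => PEmpty.elim x.1⟩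
  exact Nat.card_of_isEmpty

end

end Biset

/-! ### The double Burnside group and its rational extension -/

/-- Isomorphism classes of `(G, H)`-bisets. -/
def BisetClass (G H : Type u) [Group G] [Group H] : Type (u + 1) :=
  Quotient (Biset.isoSetoid G H)

/-- The isomorphism class of a biset. -/
def BisetClass.mk {G H : Type u} [Group G] [Group H] (X : Biset G H) : BisetClass G H :=
  Quotient.mk (Biset.isoSetoid G H) X

section

variable {G H K G' H' : Type u} [Group G] [Group H] [Group K] [Group G'] [Group H']

instance : Add (BisetClass G H) where
  add := Quotient.map₂ Biset.sum fun _ _ h _ _ k => Biset.sum_congr h k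

instance : Zero (BisetClass G H) where
  zero := BisetClass.mk (Biset.empty G H)

/-- Isomorphism classes form a commutative monoid under disjoint union. -/
instance : AddCommMonoid (BisetClass G H) where
  add_assoc := by rintro ⟨X⟩ ⟨Y⟩ ⟨Z⟩; exact Quotient.sound (Biset.sum_assoc X Y Z)
  add_comm := by rintro ⟨X⟩ ⟨Y⟩; exact Quotient.sound (Biset.sum_comm X Y)
  zero_add := by rintro ⟨X⟩; exact Quotient.sound (Biset.empty_sum X)
  add_zero := by
    rintro ⟨X⟩
    exact Quotient.sound (Setoid.trans (Biset.sum_comm X _) (Biset.empty_sum X))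
  nsmul := nsmulRec

/-- The tensor product on isomorphism classes. -/
def classTensor : BisetClass G H →+ BisetClass H K →+ BisetClass G K where
  toFun c :=
    { toFun := fun d =>
        Quotient.map₂ Biset.tensor (fun _ _ h _ _ k => Biset.tensor_congr h k) c d
      map_zero' := by
        obtain ⟨X⟩ := c
        exact Quotient.sound (Biset.tensor_empty X)
      map_add' := by
        obtain ⟨X⟩ := c
        rintro ⟨Y⟩ ⟨Y'⟩
        exact Quotient.sound (Biset.tensor_sum X Y Y') }
  map_zero' := by
    ext ⟨Y⟩
    exact Quotient.sound (Biset.empty_tensor Y)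
  map_add' := by
    rintro ⟨X⟩ ⟨X'⟩
    ext ⟨Y⟩
    exact Quotient.sound (Biset.sum_tensor X X' Y)

/-- The external product on isomorphism classes. -/
def classExt : BisetClass G H →+ BisetClass G' H' →+ BisetClass (G × G') (H × H') where
  toFun c :=
    { toFun := fun d => Quotient.map₂ Biset.ext (fun _ _ h _ _ k => Biset.ext_congr h k) c d
      map_zero' := by
        obtain ⟨X⟩ := c
        exact Quotient.sound (Biset.ext_empty X)
      map_add' := by
        obtain ⟨X⟩ := c
        rintro ⟨Y⟩ ⟨Y'⟩
        exact Quotient.sound (Biset.ext_sum X Y Y') }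
  map_zero' := by
    ext ⟨Y⟩
    exact Quotient.sound (Biset.empty_ext Y)
  map_add' := by
    rintro ⟨X⟩ ⟨X'⟩
    ext ⟨Y⟩
    exact Quotient.sound (Biset.sum_ext X X' Y)

/-- Restriction on isomorphism classes. -/
def classRes (α : G' →* G) (β : H' →* H) : BisetClass G H →+ BisetClass G' H' where
  toFun := Quotient.map (Biset.res α β) fun _ _ h => Biset.res_congr α β h
  map_zero' := Quotient.sound (Biset.res_empty α β)
  map_add' := by
    rintro ⟨X⟩ ⟨Y⟩
    exact Quotient.sound (Biset.res_sum α β X Y)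

/-- The number of `L`-fixed points on isomorphism classes. -/
def classMark (L : Subgroup (G × H)) : BisetClass G H →+ ℚ where
  toFun := Quotient.lift (fun X => (Nat.card (Biset.fixedPoints L X) : ℚ))
    fun _ _ h => congrArg Nat.cast (Biset.card_fixedPoints_congr L h)
  map_zero' := by
    change ((Nat.card (Biset.fixedPoints L (Biset.empty G H)) : ℕ) : ℚ) = 0
    rw [Biset.card_fixedPoints_empty, Nat.cast_zero]
  map_add' := by
    rintro ⟨X⟩ ⟨Y⟩
    change ((Nat.card (Biset.fixedPoints L (X.sum Y)) : ℕ) : ℚ) =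
      (Nat.card (Biset.fixedPoints L X) : ℚ) + (Nat.card (Biset.fixedPoints L Y) : ℚ)
    rw [Biset.card_fixedPoints_sum, Nat.cast_add]

/-- The double Burnside group `B(G, H)`: the Grothendieck group of `(G, H)`-bisets with respect
to disjoint unions. -/
abbrev B (G H : Type u) [Group G] [Group H] : Type (u + 1) :=
  Algebra.GrothendieckAddGroup (BisetClass G H)

/-- `ℚB(G, H) = ℚ ⊗ B(G, H)`. -/
abbrev QB (G H : Type u) [Group G] [Group H] : Type (u + 1) :=
  ℚ ⊗[ℤ] B G H

/-- The canonical map from isomorphism classes of bisets to `ℚB(G, H)`. -/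
def toQB : BisetClass G H →+ QB G H where
  toFun c := 1 ⊗ₜ[ℤ] Algebra.GrothendieckAddGroup.of c
  map_zero' := by rw [map_zero, TensorProduct.tmul_zero]
  map_add' c d := by rw [map_add, TensorProduct.tmul_add]

/-- The element `[X]` of `ℚB(G, H)`. -/
def cls (X : Biset G H) : QB G H :=
  toQB (BisetClass.mk X)

/-- The `ℚ`-linear extension to `ℚB(G, H)` of an additive map on isomorphism classes. -/
def extend {V : Type*} [AddCommGroup V] [Module ℚ V] (f : BisetClass G H →+ V) :
    QB G H →ₗ[ℚ] V :=
  LinearMap.liftBaseChange ℚ (Algebra.GrothendieckAddGroup.lift f).toIntLinearMap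

theorem extend_toQB {V : Type*} [AddCommGroup V] [Module ℚ V] (f : BisetClass G H →+ V)
    (c : BisetClass G H) : extend f (toQB c) = f c := by
  have h := DFunLike.congr_fun (Algebra.GrothendieckAddGroup.lift.symm_apply_apply f) c
  change LinearMap.liftBaseChange ℚ (Algebra.GrothendieckAddGroup.lift f).toIntLinearMap
    (1 ⊗ₜ[ℤ] Algebra.GrothendieckAddGroup.of c) = f c
  rw [LinearMap.liftBaseChange_one_tmul]
  exact h

theorem extend_add {V : Type*} [AddCommGroup V] [Module ℚ V] (f g : BisetClass G H →+ V) :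
    extend (f + g) = extend f + extend g := by
  have h : (Algebra.GrothendieckAddGroup.lift (f + g)).toIntLinearMap =
      (Algebra.GrothendieckAddGroup.lift f).toIntLinearMap +
        (Algebra.GrothendieckAddGroup.lift g).toIntLinearMap := by
    have h' : Algebra.GrothendieckAddGroup.lift (f + g) =
        Algebra.GrothendieckAddGroup.lift f + Algebra.GrothendieckAddGroup.lift g := by
      apply Algebra.GrothendieckAddGroup.lift.symm.injective
      rw [Equiv.symm_apply_apply, Algebra.GrothendieckAddGroup.lift_symm_apply,
        AddMonoidHom.add_comp, ← Algebra.GrothendieckAddGroup.lift_symm_apply,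
        ← Algebra.GrothendieckAddGroup.lift_symm_apply, Equiv.symm_apply_apply,
        Equiv.symm_apply_apply]
    rw [h']
    rfl
  rw [extend, h]
  exact map_add (LinearMap.liftBaseChangeEquiv ℚ) _ _

/-- The `ℚ`-bilinear extension of a biadditive map on isomorphism classes. -/
def extend₂ {G₁ H₁ G₂ H₂ G₃ H₃ : Type u} [Group G₁] [Group H₁] [Group G₂] [Group H₂]
    [Group G₃] [Group H₃] (f : BisetClass G₁ H₁ →+ BisetClass G₂ H₂ →+ BisetClass G₃ H₃) :
    QB G₁ H₁ →ₗ[ℚ] QB G₂ H₂ →ₗ[ℚ] QB G₃ H₃ :=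
  extend
    { toFun := fun c => extend (toQB.comp (f c))
      map_zero' := by
        have h := extend_add (0 : BisetClass G₂ H₂ →+ QB G₃ H₃) 0
        rw [add_zero, left_eq_add] at h
        rw [map_zero, AddMonoidHom.comp_zero, h]
      map_add' := fun c d => by rw [map_add, AddMonoidHom.comp_add, extend_add] }

/-- The product `ℚB(G, H) × ℚB(H, K) → ℚB(G, K)` with `[X] ⬝ [Y] = [X ×_H Y]`. -/
def dot : QB G H →ₗ[ℚ] QB H K →ₗ[ℚ] QB G K :=
  extend₂ classTensor

/-- The external product on `ℚB`, with `[X] × [Y] = [X × Y]`. -/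
def extProd : QB G H →ₗ[ℚ] QB G' H' →ₗ[ℚ] QB (G × G') (H × H') :=
  extend₂ classExt

/-- Restriction on `ℚB` along group homomorphisms. -/
def restrict (α : G' →* G) (β : H' →* H) : QB G H →ₗ[ℚ] QB G' H' :=
  extend (toQB.comp (classRes α β))

/-- The mark `Φ_L : ℚB(G, H) → ℚ`, with `Φ_L [X] = |X^L|`. -/
def mark (L : Subgroup (G × H)) : QB G H →ₗ[ℚ] ℚ :=
  extend (classMark L)

theorem dot_cls (X : Biset G H) (Y : Biset H K) : dot (cls X) (cls Y) = cls (X.tensor Y) := by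
  rw [dot, extend₂, cls, extend_toQB]
  exact extend_toQB _ _

theorem extProd_cls (X : Biset G H) (Y : Biset G' H') :
    extProd (cls X) (cls Y) = cls (X.ext Y) := by
  rw [extProd, extend₂, cls, extend_toQB]
  exact extend_toQB _ _

theorem restrict_cls (α : G' →* G) (β : H' →* H) (X : Biset G H) :
    restrict α β (cls X) = cls (X.res α β) :=
  extend_toQB _ _

theorem mark_cls (L : Subgroup (G × H)) (X : Biset G H) :
    mark L (cls X) = Nat.card (Biset.fixedPoints L X) :=
  extend_toQB _ _

/-! ### Twisted diagonal subgroups and the bifree part -/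

/-- For a homomorphism `φ : V → G` defined on a subgroup `V ≤ H`, the subgroup
`{(φ(h), h) | h ∈ V}` of `G × H`. For injective `φ` this is `Δ(φ(V), φ, V)`. -/
def graph (V : Subgroup H) (φ : V →* G) : Subgroup (G × H) :=
  (φ.prod V.subtype).range

/-- The set `Δ_{G,H}` of twisted diagonal subgroups of `G × H`. -/
def twistedDiagonals (G H : Type u) [Group G] [Group H] : Set (Subgroup (G × H)) :=
  {L | ∃ (V : Subgroup H) (φ : V →* G), Function.Injective φ ∧ L = graph V φ}

/-- The diagonal homomorphism `G → G × G`. -/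
def diag (G : Type u) [Group G] : G →* G × G :=
  (MonoidHom.id G).prod (MonoidHom.id G)

/-- The diagonal subgroup `Δ(G)` of `G × G`. -/
def diagonal (G : Type u) [Group G] : Subgroup (G × G) :=
  (diag G).range

/-- The opposite `L° = {(h, g) | (g, h) ∈ L}`. -/
def opposite (L : Subgroup (G × H)) : Subgroup (H × G) where
  carrier := {a | (a.2, a.1) ∈ L}
  mul_mem' := fun {_ _} ha hb => L.mul_mem ha hb
  one_mem' := L.one_mem
  inv_mem' := fun {_} ha => L.inv_mem ha

/-- The product `L * M` of `(g, k)` such that `(g, h) ∈ L` and `(h, k) ∈ M` for some `h`. -/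
def star (L : Subgroup (G × H)) (M : Subgroup (H × K)) : Subgroup (G × K) where
  carrier := {a | ∃ h : H, (a.1, h) ∈ L ∧ (h, a.2) ∈ M}
  mul_mem' := by
    rintro a b ⟨h, h1, h2⟩ ⟨k, k1, k2⟩
    exact ⟨h * k, L.mul_mem h1 k1, M.mul_mem h2 k2⟩
  one_mem' := ⟨1, L.one_mem, M.one_mem⟩
  inv_mem' := by
    rintro a ⟨h, h1, h2⟩
    exact ⟨h⁻¹, L.inv_mem h1, M.inv_mem h2⟩

/-- `ℚB^Δ(G, H)`, spanned by the `[(G × H) / L]` with `L` twisted diagonal. -/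
def bifree (G H : Type u) [Group G] [Group H] [Finite G] [Finite H] :
    Submodule ℚ (QB G H) :=
  Submodule.span ℚ {a | ∃ L ∈ twistedDiagonals G H, a = cls (Biset.coset L)}

end

/-! ### Frobenius elements and the set `Idem(S)` -/

section

variable {S : Type u} [Group S]

/-- Right Frobenius: `a × a = (a × [S]) ⬝ a` in `ℚB(S × S, S)`, where `a × a` and `a × [S]` are
restricted along the diagonal on the right. -/
def IsRightFrobenius [Finite S] (a : QB S S) : Prop :=
  restrict (MonoidHom.id (S × S)) (diag S) (extProd a a) =
    dot (restrict (MonoidHom.id (S × S)) (diag S) (extProd a (cls (Biset.regular S)))) a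

/-- Left Frobenius: `a × a = a ⬝ (a × [S])` in `ℚB(S, S × S)`, where `a × a` and `a × [S]` are
restricted along the diagonal on the left. -/
def IsLeftFrobenius [Finite S] (a : QB S S) : Prop :=
  restrict (diag S) (MonoidHom.id (S × S)) (extProd a a) =
    dot a (restrict (diag S) (MonoidHom.id (S × S)) (extProd a (cls (Biset.regular S))))

/-- The set `Fix(a)` of twisted diagonal subgroups at which the mark of `a` is nonzero. -/
def Fix (a : QB S S) : Set (Subgroup (S × S)) :=
  {L | L ∈ twistedDiagonals S S ∧ mark L a ≠ 0}

/-- The set `Idem(S)`. -/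
def Idem (S : Type u) [Group S] [Finite S] : Set (QB S S) :=
  {a | a ∈ bifree S S ∧ dot a a = a ∧ IsRightFrobenius a ∧ IsLeftFrobenius a ∧
    (∀ L ∈ Fix a, ∀ M ≤ L, M ∈ Fix a) ∧ diagonal S ∈ Fix a}

/-! ### Fusion systems -/

/-- A fusion system on `S`: a category whose objects are the subgroups of `S`, whose morphisms
are injective group homomorphisms (composed as maps), which contains all conjugations by elements
of `S`, and which contains with `φ : P → Q` the isomorphism `P → φ(P)` and its inverse. -/
@[ext]
structure FusionSystem (S : Type u) [Group S] : Type u where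
  Hom : ∀ P Q : Subgroup S, Set (P →* Q)
  comp_mem : ∀ {P Q R : Subgroup S} {φ : P →* Q} {ψ : Q →* R},
    φ ∈ Hom P Q → ψ ∈ Hom Q R → ψ.comp φ ∈ Hom P R
  conj_mem : ∀ {P Q : Subgroup S} (s : S) (φ : P →* Q),
    (∀ u : P, (φ u : S) = s * u * s⁻¹) → φ ∈ Hom P Q
  injective : ∀ {P Q : Subgroup S} {φ : P →* Q}, φ ∈ Hom P Q → Function.Injective φ
  iso_mem : ∀ {P Q : Subgroup S} {φ : P →* Q}, φ ∈ Hom P Q →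
    ∀ e : P ≃* (φ.range.map Q.subtype : Subgroup S), (∀ u : P, (e u : S) = φ u) →
      e.toMonoidHom ∈ Hom P (φ.range.map Q.subtype) ∧
      e.symm.toMonoidHom ∈ Hom (φ.range.map Q.subtype) P

/-- `S(F) = {Δ(φ(P), φ, P) | P ≤ S, φ ∈ Hom_F(P, S)}`. -/
def FusionSystem.system (F : FusionSystem S) : Set (Subgroup (S × S)) :=
  {L | ∃ (P : Subgroup S) (φ : P →* (⊤ : Subgroup S)), φ ∈ F.Hom P ⊤ ∧
    L = graph P ((⊤ : Subgroup S).subtype.comp φ)}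

/-- The set `Sys(S)` of sets of twisted diagonal subgroups of `S × S` that are closed under
conjugation, subgroups, `*` and opposites, and contain `Δ(S)`. -/
def Sys (S : Type u) [Group S] : Set (Set (Subgroup (S × S))) :=
  {T | T ⊆ twistedDiagonals S S ∧
    (∀ L ∈ T, ∀ a : S × S, L.map (MulAut.conj a).toMonoidHom ∈ T) ∧
    (∀ L ∈ T, ∀ M ≤ L, M ∈ T) ∧
    (∀ L ∈ T, ∀ M ∈ T, star L M ∈ T) ∧
    diagonal S ∈ T ∧
    opposite '' T = T}

/-- `ω` is an element `ω_F` of `ℚB^Δ(S, S)`: its mark at `L` is `|S| / |Hom_F(p₁(L), S)|` if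
`L ∈ S(F)`, and `0` otherwise. -/
def IsOmega [Finite S] (F : FusionSystem S) (ω : QB S S) : Prop :=
  ω ∈ bifree S S ∧
  ∀ L : Subgroup (S × S),
    (L ∈ F.system → mark L ω =
      (Nat.card S : ℚ) / (Nat.card (F.Hom (L.map (MonoidHom.fst S S)) ⊤) : ℚ)) ∧
    (L ∉ F.system → mark L ω = 0)

end

end DoubleBurnside
end

/-! Everything is read off from marks. By triangularity of the table of marks, an element of ℚB(G,
H) is determined by its marks (`ext_mark`), and a conjugation invariant function supported in a
family of subgroups closed under conjugation and subgroups is the mark function of a combination of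
transitive bisets from that family (`exists_mark_eq`).

Index marks by pairs of homomorphisms from an auxiliary group W: let m(α, β) be the mark at {(α(w),
β(w))}. If one factor is free over H, then |H| m_{a·b}(α, γ) = ∑_θ m_a(α, θ) m_b(θ, γ), summed over
all θ : W → H (`card_fixed_tensor`). The marks of the regular biset link only conjugate
homomorphisms, so the Frobenius equations become the pointwise identities m(α₁, γ) m(α₂, γ) = m(α₁,
α₂) m(α₂, γ) and m(α, γ₁) m(α, γ₂) = m(α, γ₂) m(γ₂, γ₁).

For ω in Idem(S), m(α, α) ≠ 0, because {(α(w), α(w))} lies in Δ(S). The identities then make m(α, β)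
≠ 0 an equivalence relation on Hom(W, S), and m takes a single value c on all pairs inside one
class. Idempotency at (α, α) reads |S| c = N c² with N the size of the class, so c = |S| / N. Hence
Fix(ω) lies in Sys(S) and determines ω (`hasSystemMarks_Fix`). Conversely, each T in Sys(S) defines
such an equivalence relation, and the function |S| / N on its classes, zero elsewhere, satisfies all
the conditions (`HasSystemMarks.mem_Idem`).

On the other side, a fusion system is the same as the set of graphs of its morphisms (`mem_hom_iff`,
`ofSystem`), and N becomes |Hom_F(α(W), S)| (`linkCount_eq_card_hom`). So h is bijective, g is
injective and g ∘ f = h, which makes all three maps bijective. -/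

noncomputable section

namespace DoubleBurnside

/-! ### Bisets as left G × H-sets, and splitting off an orbit -/

namespace Biset

variable {G H : Type u} [Group G] [Group H]

/-- A `(G, H)`-biset as a left `G × H`-set, with `(g, h) x = g x h⁻¹`. -/
instance prodAction (X : Biset G H) : MulAction (G × H) X.carrier where
  smul a x := a.1 • MulOpposite.op a.2⁻¹ • x
  one_smul x := by
    change (1 : G) • MulOpposite.op (1 : H)⁻¹ • x = x
    simp
  mul_smul a b x := by
    change (a.1 * b.1) • MulOpposite.op (a.2 * b.2)⁻¹ • x =
      a.1 • MulOpposite.op a.2⁻¹ • b.1 • MulOpposite.op b.2⁻¹ • x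
    rw [mul_inv_rev, MulOpposite.op_mul, mul_smul, mul_smul, smul_comm b.1]

theorem prod_smul_def (X : Biset G H) (a : G × H) (x : X.carrier) :
    a • x = a.1 • MulOpposite.op a.2⁻¹ • x := rfl

theorem left_smul_eq (X : Biset G H) (g : G) (x : X.carrier) : g • x = (g, (1 : H)) • x := by
  simp [prod_smul_def]

theorem right_smul_eq (X : Biset G H) (h : H) (x : X.carrier) :
    MulOpposite.op h • x = ((1 : G), h⁻¹) • x := by
  simp [prod_smul_def]

theorem mem_fixedPoints {L : Subgroup (G × H)} {X : Biset G H} {x : X.carrier} :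
    x ∈ fixedPoints L X ↔ ∀ a ∈ L, a • x = x := Iff.rfl

theorem equiv_of_prod_equivariant {X Y : Biset G H} (e : X.carrier ≃ Y.carrier)
    (he : ∀ (a : G × H) (x : X.carrier), e (a • x) = a • e x) : X ≈ Y :=
  ⟨e, fun g x => by rw [left_smul_eq, he, ← left_smul_eq],
    fun h x => by rw [right_smul_eq, he, ← right_smul_eq]⟩

/-- The biset attached to a finite left `G × H`-set. -/
def ofProd (C : Type u) [Finite C] [MulAction (G × H) C] : Biset G H :=
  ofMaps C (fun g x => ((g, 1) : G × H) • x) (fun h x => ((1, h⁻¹) : G × H) • x)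
    (fun x => one_smul (G × H) x)
    (fun g g' x => by simp [smul_smul])
    (fun x => by
      rw [inv_one]
      exact one_smul (G × H) x)
    (fun h h' x => by simp [smul_smul])
    (fun g h x => by simp [smul_smul])

/-- The carrier of `ofProd C` is `C` itself, so two actions of the same group live on one type; the
statement names both instances to keep them apart. -/
theorem ofProd_smul (C : Type u) [Finite C] [i : MulAction (G × H) C] (a : G × H) (x : C) :
    (prodAction (ofProd C)).smul a x = i.smul a x := by
  change ((a.1, 1) : G × H) • ((1, a.2⁻¹⁻¹) : G × H) • x = a • x
  rw [smul_smul]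
  simp

theorem coset_smul [Finite G] [Finite H] (L : Subgroup (G × H)) (a : G × H)
    (x : (G × H) ⧸ L) : (prodAction (coset L)).smul a x = a • x :=
  ofProd_smul ((G × H) ⧸ L) a x

/-- The part of a biset outside the orbit of `x`. -/
def orbitCompl (X : Biset G H) (x : X.carrier) : SubMulAction (G × H) X.carrier where
  carrier := (MulAction.orbit (G × H) x)ᶜ
  smul_mem' a y hy := by
    rintro ⟨b, hb : b • x = a • y⟩
    exact hy ⟨a⁻¹ * b, show (a⁻¹ * b) • x = y by rw [mul_smul, hb, inv_smul_smul]⟩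

/-- Orbit-stabilizer for the orbit of `x`; this is the induction step that decomposes a biset into
transitive ones. -/
theorem equiv_coset_sum [Finite G] [Finite H] (X : Biset G H) (x : X.carrier) :
    X ≈ (coset (MulAction.stabilizer (G × H) x)).sum (ofProd (X.orbitCompl x)) := by
  classical
  let σ := MulAction.orbitEquivQuotientStabilizer (G × H) x
  let e : (coset (MulAction.stabilizer (G × H) x)).carrier ⊕
      (ofProd (G := G) (H := H) (X.orbitCompl x)).carrier ≃ X.carrier :=
    (Equiv.sumCongr σ.symm (Equiv.refl _)).trans
      (Equiv.Set.sumCompl (MulAction.orbit (G × H) x))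
  refine Setoid.symm (equiv_of_prod_equivariant e ?_)
  rintro a (y | y)
  · change (σ.symm ((prodAction (coset (MulAction.stabilizer (G × H) x))).smul a y) : X.carrier) =
      a • (σ.symm y : X.carrier)
    have h := coset_smul (MulAction.stabilizer (G × H) x) a y
    refine (congrArg (fun z => (σ.symm z : X.carrier)) h).trans ?_
    obtain ⟨z, rfl⟩ := QuotientGroup.mk_surjective (s := MulAction.stabilizer (G × H) x) y
    exact mul_smul a z x
  · change ((prodAction (ofProd (X.orbitCompl x))).smul a y : X.orbitCompl x).1 =
      a • (y : X.orbitCompl x).1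
    exact congrArg Subtype.val (ofProd_smul (X.orbitCompl x) a y)

end Biset

/-! ### Spanning sets of ℚB(G, H) -/

variable {G H : Type u} [Group G] [Group H]

theorem cls_eq_of_equiv {X Y : Biset G H} (h : X ≈ Y) : cls X = cls Y :=
  congrArg toQB (Quotient.sound h)

theorem cls_sum (X Y : Biset G H) : cls (X.sum Y) = cls X + cls Y :=
  toQB.map_add (BisetClass.mk X) (BisetClass.mk Y)

/-- Elements of a Grothendieck group are differences of classes. Hence identities between linear
maps need checking only on actual bisets. -/
theorem span_cls_eq_top :
    Submodule.span ℚ (Set.range (cls : Biset G H → QB G H)) = ⊤ := by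
  rw [eq_top_iff]
  rintro a -
  induction a using TensorProduct.induction_on with
  | zero => exact Submodule.zero_mem _
  | add a b ha hb => exact Submodule.add_mem _ ha hb
  | tmul q b =>
    have key : ∀ c : BisetClass G H, (1 : ℚ) ⊗ₜ[ℤ] Algebra.GrothendieckAddGroup.of c ∈
        Submodule.span ℚ (Set.range (cls : Biset G H → QB G H)) := by
      rintro ⟨X⟩
      exact Submodule.subset_span ⟨X, rfl⟩
    have h : q ⊗ₜ[ℤ] b = q • ((1 : ℚ) ⊗ₜ[ℤ] b) := by
      rw [TensorProduct.smul_tmul', smul_eq_mul, mul_one]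
    rw [h]
    refine Submodule.smul_mem _ _ ?_
    induction b using AddLocalization.induction_on with
    | H y =>
      have hy : AddLocalization.mk y.1 y.2 = Algebra.GrothendieckAddGroup.of y.1 -
          Algebra.GrothendieckAddGroup.of (y.2 : BisetClass G H) := by
        rw [eq_sub_iff_add_eq]
        change _ + AddLocalization.mk (y.2 : BisetClass G H) 0 = AddLocalization.mk y.1 0
        rw [AddLocalization.mk_add, AddLocalization.mk_eq_mk_iff, AddLocalization.r_iff_exists]
        exact ⟨0, by simp [add_comm]⟩
      rw [hy, TensorProduct.tmul_sub]
      exact Submodule.sub_mem _ (key _) (key _)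

theorem span_coset_eq_top [Finite G] [Finite H] :
    Submodule.span ℚ (Set.range fun L : Subgroup (G × H) => cls (Biset.coset L)) = ⊤ := by
  rw [eq_top_iff, ← span_cls_eq_top, Submodule.span_le]
  rintro _ ⟨X, rfl⟩
  induction hn : Nat.card X.carrier using Nat.strong_induction_on generalizing X with
  | _ n ih =>
    by_cases hX : Nonempty X.carrier
    · obtain ⟨x⟩ := hX
      rw [SetLike.mem_coe, cls_eq_of_equiv (X.equiv_coset_sum x), cls_sum]
      refine Submodule.add_mem _ (Submodule.subset_span ⟨_, rfl⟩) (ih _ ?_ _ rfl)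
      rw [← hn]
      exact Finite.card_subtype_lt (x := x)
        (fun h : x ∈ (MulAction.orbit (G × H) x)ᶜ => h (MulAction.mem_orbit_self x))
    · rw [not_nonempty_iff] at hX
      have hE : IsEmpty (Biset.empty G H).carrier := inferInstanceAs (IsEmpty PEmpty)
      have h : X ≈ Biset.empty G H :=
        Biset.equiv_of_prod_equivariant (Equiv.equivOfIsEmpty _ _) fun _ x => isEmptyElim x
      rw [SetLike.mem_coe, cls_eq_of_equiv h]
      have h0 : cls (Biset.empty G H) = 0 := toQB.map_zero
      rw [h0]
      exact Submodule.zero_mem _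


section

variable {G H : Type u} [Group G] [Group H]

theorem linearMap_ext_cls {V : Type*} [AddCommGroup V] [Module ℚ V] {f g : QB G H →ₗ[ℚ] V}
    (h : ∀ X : Biset G H, f (cls X) = g (cls X)) : f = g :=
  LinearMap.ext_on_range span_cls_eq_top h

theorem mark_map_conj (L : Subgroup (G × H)) (a : G × H) :
    mark (L.map (MulAut.conj a).toMonoidHom) = mark L := by
  refine linearMap_ext_cls fun X => ?_
  rw [mark_cls, mark_cls]
  congr 1
  refine (Nat.card_congr (Equiv.subtypeEquiv (MulAction.toPerm a) fun x => ?_)).symm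
  change x ∈ Biset.fixedPoints L X ↔ a • x ∈ Biset.fixedPoints _ X
  simp only [Biset.mem_fixedPoints, Subgroup.mem_map, forall_exists_index, and_imp,
    forall_apply_eq_imp_iff₂]
  refine forall₂_congr fun b _ => ?_
  change b • x = x ↔ (a * b * a⁻¹) • a • x = a • x
  rw [mul_smul, inv_smul_smul, mul_smul, smul_left_cancel_iff]

end

/-! ### Marks of transitive bisets and triangularity -/

section

variable {G H : Type u} [Group G] [Group H] [Finite G] [Finite H]

theorem mark_coset (L M : Subgroup (G × H)) :
    mark L (cls (Biset.coset M)) =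
      Nat.card {y : (G × H) ⧸ M // ∀ a ∈ L, a • y = y} := by
  rw [mark_cls]
  congr 1
  refine Nat.card_congr (Equiv.subtypeEquivRight fun y => forall₂_congr fun a _ => ?_)
  exact Eq.congr_left (Biset.coset_smul M a y)

theorem mark_coset_nonneg (L M : Subgroup (G × H)) : 0 ≤ mark L (cls (Biset.coset M)) := by
  rw [mark_coset]
  exact Nat.cast_nonneg _

theorem mark_coset_self_pos (L : Subgroup (G × H)) : 0 < mark L (cls (Biset.coset L)) := by
  rw [mark_coset, Nat.cast_pos]
  have : Nonempty {y : (G × H) ⧸ L // ∀ a ∈ L, a • y = y} :=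
    ⟨⟨((1 : G × H) : (G × H) ⧸ L), fun a ha => by
      change ((a * 1 : G × H) : (G × H) ⧸ L) = ((1 : G × H) : (G × H) ⧸ L)
      rw [mul_one, eq_comm, QuotientGroup.eq]
      simpa using ha⟩⟩
  exact Nat.card_pos

/-- A coset `aM` is fixed by `L` exactly when `a⁻¹La ≤ M`. This makes the table of marks triangular
with respect to the order of subgroups. -/
theorem exists_map_conj_le_of_mark_coset_ne_zero {L M : Subgroup (G × H)}
    (h : mark L (cls (Biset.coset M)) ≠ 0) :
    ∃ a : G × H, L.map (MulAut.conj a).toMonoidHom ≤ M := by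
  rw [mark_coset, Nat.cast_ne_zero, Nat.card_ne_zero] at h
  obtain ⟨⟨⟨y, hy⟩⟩, -⟩ := h
  obtain ⟨a, rfl⟩ := QuotientGroup.mk_surjective y
  refine ⟨a⁻¹, ?_⟩
  rintro _ ⟨b, hb, rfl⟩
  have h1 : ((b * a : G × H) : (G × H) ⧸ M) = (a : G × H) := hy b hb
  rw [eq_comm, QuotientGroup.eq] at h1
  simpa [mul_assoc] using h1

theorem card_map_conj {A : Type*} [Group A] (L : Subgroup A) (a : A) :
    Nat.card (L.map (MulAut.conj a).toMonoidHom) = Nat.card L :=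
  Nat.card_congr (L.equivMapOfInjective _ (MulAut.conj a).injective).symm.toEquiv

theorem map_conj_inv_map_conj {A : Type*} [Group A] (L : Subgroup A) (a : A) :
    (L.map (MulAut.conj a).toMonoidHom).map (MulAut.conj a⁻¹).toMonoidHom = L := by
  rw [Subgroup.map_map]
  convert Subgroup.map_id L
  ext x
  simp [mul_assoc]

theorem map_conj_eq_of_mark_coset_ne_zero {L M : Subgroup (G × H)}
    (h : mark L (cls (Biset.coset M)) ≠ 0) (hc : Nat.card M ≤ Nat.card L) :
    ∃ a : G × H, L.map (MulAut.conj a).toMonoidHom = M := by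
  obtain ⟨a, ha⟩ := exists_map_conj_le_of_mark_coset_ne_zero h
  exact ⟨a, Subgroup.eq_of_le_of_card_ge ha (by rwa [card_map_conj])⟩

theorem mark_coset_eq_zero_of_card_lt {L M : Subgroup (G × H)}
    (hc : Nat.card M < Nat.card L) : mark L (cls (Biset.coset M)) = 0 := by
  by_contra h
  obtain ⟨a, rfl⟩ := map_conj_eq_of_mark_coset_ne_zero h hc.le
  rw [card_map_conj] at hc
  exact hc.false

/-- The isomorphism is right translation `zL ↦ za⁻¹(aLa⁻¹)`. -/
theorem cls_coset_map_conj (L : Subgroup (G × H)) (a : G × H) :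
    cls (Biset.coset (L.map (MulAut.conj a).toMonoidHom)) = cls (Biset.coset L) := by
  let e : (G × H) ⧸ L ≃ (G × H) ⧸ (L.map (MulAut.conj a).toMonoidHom) :=
    Quotient.congr (Equiv.mulRight a⁻¹) fun x y => by
      rw [QuotientGroup.leftRel_apply, QuotientGroup.leftRel_apply]
      change x⁻¹ * y ∈ L ↔ (x * a⁻¹)⁻¹ * (y * a⁻¹) ∈ _
      have h : (x * a⁻¹)⁻¹ * (y * a⁻¹) = MulAut.conj a (x⁻¹ * y) := by
        simp [mul_assoc]
      rw [h]
      exact (Subgroup.mem_map_iff_mem (MulAut.conj a).injective).symm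
  refine cls_eq_of_equiv (Setoid.symm (Biset.equiv_of_prod_equivariant
    (X := Biset.coset L) (Y := Biset.coset (L.map (MulAut.conj a).toMonoidHom)) e ?_))
  intro b x
  refine ((congrArg e (Biset.coset_smul L b x)).trans ?_).trans (Biset.coset_smul _ b (e x)).symm
  obtain ⟨z, rfl⟩ := QuotientGroup.mk_surjective (s := L) x
  change (QuotientGroup.mk (b * z * a⁻¹) : (G × H) ⧸ (L.map (MulAut.conj a).toMonoidHom)) =
    QuotientGroup.mk (b * (z * a⁻¹))
  rw [mul_assoc]

variable (G H) in
open Classical in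
/-- The subgroups of `G × H` of order `n`. -/
def subgroupsOfCard (n : ℕ) : Finset (Subgroup (G × H)) :=
  (Set.toFinite {L : Subgroup (G × H) | Nat.card L = n}).toFinset

theorem mem_subgroupsOfCard {n : ℕ} {L : Subgroup (G × H)} :
    L ∈ subgroupsOfCard G H n ↔ Nat.card L = n := by
  simp [subgroupsOfCard]

/-- The sum of the marks at `L` of the transitive bisets whose stabilizers have the order
of `L`. -/
def layerWeight (L : Subgroup (G × H)) : ℚ :=
  ∑ M ∈ subgroupsOfCard G H (Nat.card L), mark L (cls (Biset.coset M))

/-- The sums run over all subgroups of a given order instead of representatives of conjugacy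
classes, so each class is counted several times; `layerWeight` is the constant that normalises this.
The term `M = L` makes it positive. -/
theorem layerWeight_pos (L : Subgroup (G × H)) : 0 < layerWeight L :=
  Finset.sum_pos' (fun M _ => mark_coset_nonneg L M)
    ⟨L, mem_subgroupsOfCard.2 rfl, mark_coset_self_pos L⟩

theorem layerWeight_map_conj (L : Subgroup (G × H)) (a : G × H) :
    layerWeight (L.map (MulAut.conj a).toMonoidHom) = layerWeight L := by
  rw [layerWeight, card_map_conj, mark_map_conj, layerWeight]

/-- The combination of transitive bisets with stabilizers of order `n` whose marks at the
subgroups of order `n` are the values of `m`. -/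
def layer (n : ℕ) (m : Subgroup (G × H) → ℚ) : QB G H :=
  ∑ M ∈ subgroupsOfCard G H n, (m M / layerWeight M) • cls (Biset.coset M)

theorem mark_layer_of_card_gt {n : ℕ} (m : Subgroup (G × H) → ℚ) {L : Subgroup (G × H)}
    (h : n < Nat.card L) : mark L (layer n m) = 0 := by
  rw [layer, map_sum]
  refine Finset.sum_eq_zero fun M hM => ?_
  rw [map_smul, mark_coset_eq_zero_of_card_lt (by rwa [mem_subgroupsOfCard.1 hM]), smul_zero]

/-- Among subgroups of the order of `L`, only conjugates of `L` contribute. There `m` and the weight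
have the same values as at `L`, so they factor out and the remaining sum is `layerWeight L`. -/
theorem mark_layer_of_card_eq {n : ℕ} {m : Subgroup (G × H) → ℚ}
    (hm : ∀ L a, m (L.map (MulAut.conj a).toMonoidHom) = m L) {L : Subgroup (G × H)}
    (h : Nat.card L = n) : mark L (layer n m) = m L := by
  subst h
  have key : ∀ M ∈ subgroupsOfCard G H (Nat.card L),
      mark L ((m M / layerWeight M) • cls (Biset.coset M)) =
        (m L / layerWeight L) * mark L (cls (Biset.coset M)) := by
    intro M hM
    rw [map_smul, smul_eq_mul]
    by_cases h0 : mark L (cls (Biset.coset M)) = 0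
    · rw [h0, mul_zero, mul_zero]
    · obtain ⟨a, rfl⟩ := map_conj_eq_of_mark_coset_ne_zero h0 (mem_subgroupsOfCard.1 hM).le
      rw [hm, layerWeight_map_conj]
  rw [layer, map_sum, Finset.sum_congr rfl key, ← Finset.mul_sum]
  exact div_mul_cancel₀ _ (layerWeight_pos L).ne'

/-- For `M` conjugate to `N` the classes, marks and weights of the two agree; otherwise both cross
marks vanish. Either way each term is a multiple of the class of `N`, and the multiples add up to 1.
-/
theorem layer_mark_coset (N : Subgroup (G × H)) :
    layer (Nat.card N) (fun M => mark M (cls (Biset.coset N))) = cls (Biset.coset N) := by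
  have key : ∀ M ∈ subgroupsOfCard G H (Nat.card N),
      (mark M (cls (Biset.coset N)) / layerWeight M) • cls (Biset.coset M) =
        (mark N (cls (Biset.coset M)) / layerWeight N) • cls (Biset.coset N) := by
    intro M hM
    have hc := mem_subgroupsOfCard.1 hM
    by_cases h : ∃ a : G × H, M.map (MulAut.conj a).toMonoidHom = N
    · obtain ⟨a, rfl⟩ := h
      rw [layerWeight_map_conj, cls_coset_map_conj, mark_map_conj]
    · have h1 : mark M (cls (Biset.coset N)) = 0 := by
        by_contra h0
        exact h (map_conj_eq_of_mark_coset_ne_zero h0 hc.ge)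
      have h2 : mark N (cls (Biset.coset M)) = 0 := by
        by_contra h0
        obtain ⟨a, ha⟩ := map_conj_eq_of_mark_coset_ne_zero h0 hc.le
        refine h ⟨a⁻¹, ?_⟩
        rw [← ha, map_conj_inv_map_conj]
      rw [h1, h2, zero_div, zero_div, zero_smul, zero_smul]
  rw [layer, Finset.sum_congr rfl key, ← Finset.sum_smul, ← Finset.sum_div]
  change (layerWeight N / layerWeight N) • _ = _
  rw [div_self (layerWeight_pos N).ne', one_smul]

theorem layer_mark_coset_of_card_lt {n : ℕ} {N : Subgroup (G × H)} (h : Nat.card N < n) :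
    layer n (fun M => mark M (cls (Biset.coset N))) = 0 :=
  Finset.sum_eq_zero fun M hM => by
    beta_reduce
    rw [mark_coset_eq_zero_of_card_lt (by rwa [mem_subgroupsOfCard.1 hM]), zero_div, zero_smul]

/-- The map sending `a` to the layer of order `n` of its marks. -/
def layerMap (n : ℕ) : QB G H →ₗ[ℚ] QB G H :=
  ∑ M ∈ subgroupsOfCard G H n,
    ((layerWeight M)⁻¹ • mark M).smulRight (cls (Biset.coset M))

theorem layerMap_apply (n : ℕ) (a : QB G H) : layerMap n a = layer n fun M => mark M a := by
  simp [layerMap, layer, div_eq_inv_mul]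

/-- `layerMap n` depends only on marks, so it kills `a`. On a combination of transitive bisets with
stabilizers of order at most `n` it returns the part of order exactly `n`. So the top layer of `a`
can be removed repeatedly. -/
theorem eq_zero_of_mark_eq_zero {a : QB G H} (ha : ∀ L, mark L a = 0) : a = 0 := by
  have key : ∀ n : ℕ, a ∈ Submodule.span ℚ
      ((fun L : Subgroup (G × H) => cls (Biset.coset L)) '' {L | Nat.card L < n}) → a = 0 := by
    intro n
    induction n with
    | zero => simp
    | succ n ih =>
      intro h
      refine ih ?_
      clear ih
      have h0 : layerMap n a = 0 := by simp [layerMap_apply, layer, ha]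
      -- The span induction below varies `a`, so facts special to this `a` must leave the context.
      clear ha
      have h' : a - layerMap n a ∈ Submodule.span ℚ
          ((fun L : Subgroup (G × H) => cls (Biset.coset L)) '' {L | Nat.card L < n}) := by
        clear h0
        induction h using Submodule.span_induction with
        | mem x hx =>
          obtain ⟨L, hL, rfl⟩ := hx
          rw [layerMap_apply]
          rcases (Nat.lt_succ_iff.1 hL).lt_or_eq with hlt | rfl
          · rw [layer_mark_coset_of_card_lt hlt, sub_zero]
            exact Submodule.subset_span ⟨L, hlt, rfl⟩
          · rw [layer_mark_coset, sub_self]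
            exact Submodule.zero_mem _
        | zero => rw [map_zero, sub_zero]; exact Submodule.zero_mem _
        | add x y _ _ hx hy =>
          rw [map_add, add_sub_add_comm]
          exact Submodule.add_mem _ hx hy
        | smul c x _ hx =>
          rw [map_smul, ← smul_sub]
          exact Submodule.smul_mem _ _ hx
      rwa [h0, sub_zero] at h'
  refine key (Nat.card (G × H) + 1) ?_
  have h : (fun L : Subgroup (G × H) => cls (Biset.coset L)) ''
      {L | Nat.card L < Nat.card (G × H) + 1} =
      Set.range fun L : Subgroup (G × H) => cls (Biset.coset L) := by
    rw [← Set.image_univ]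
    congr 1
    ext L
    simpa using Nat.lt_succ_of_le (Subgroup.card_le_card_group L)
  rw [h, span_coset_eq_top]
  exact Submodule.mem_top

/-- Elements of `ℚB(G, H)` are determined by their marks. -/
theorem ext_mark {a b : QB G H} (h : ∀ L, mark L a = mark L b) : a = b :=
  sub_eq_zero.1 (eq_zero_of_mark_eq_zero fun L => by rw [map_sub, h, sub_self])

/-- A conjugation invariant function is the function of marks of an element in the span of the
transitive bisets with stabilizers in its support, when that support is closed under passage
to subgroups. -/
theorem exists_mark_eq (T : Set (Subgroup (G × H))) (hT : ∀ L ∈ T, ∀ M ≤ L, M ∈ T)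
    (hTc : ∀ L ∈ T, ∀ a : G × H, L.map (MulAut.conj a).toMonoidHom ∈ T)
    (m : Subgroup (G × H) → ℚ) (hm : ∀ L a, m (L.map (MulAut.conj a).toMonoidHom) = m L)
    (hm0 : ∀ L, m L ≠ 0 → L ∈ T) :
    ∃ a ∈ Submodule.span ℚ ((fun L => cls (Biset.coset L)) '' T), ∀ L, mark L a = m L := by
  have key : ∀ n : ℕ, ∀ m : Subgroup (G × H) → ℚ,
      (∀ L a, m (L.map (MulAut.conj a).toMonoidHom) = m L) → (∀ L, m L ≠ 0 → L ∈ T) →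
      (∀ L, m L ≠ 0 → Nat.card L < n) →
      ∃ a ∈ Submodule.span ℚ ((fun L => cls (Biset.coset L)) '' T), ∀ L, mark L a = m L := by
    intro n
    induction n with
    | zero =>
      intro m _ _ h
      refine ⟨0, Submodule.zero_mem _, fun L => ?_⟩
      rw [map_zero]
      by_contra h0
      exact absurd (h L (Ne.symm h0)) (Nat.not_lt_zero _)
    | succ n ih =>
      intro m hm hm0 hn
      have hmem : layer n m ∈ Submodule.span ℚ ((fun L => cls (Biset.coset L)) '' T) := by
        refine Submodule.sum_mem _ fun M _ => ?_
        by_cases h0 : m M = 0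
        · rw [h0, zero_div, zero_smul]
          exact Submodule.zero_mem _
        · exact Submodule.smul_mem _ _ (Submodule.subset_span ⟨M, hm0 M h0, rfl⟩)
      -- A nonzero mark at `L` comes from some `M` in the support with `L` subconjugate to `M`; the
      -- two closure properties of `T` bring `L` back into `T`.
      have hsupp : ∀ L, mark L (layer n m) ≠ 0 → L ∈ T := by
        intro L hL
        by_contra hLT
        refine hL ?_
        rw [layer, map_sum]
        refine Finset.sum_eq_zero fun M _ => ?_
        rw [map_smul, smul_eq_mul]
        by_contra h0
        have hM : m M ≠ 0 := fun h => h0 (by rw [h, zero_div, zero_mul])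
        obtain ⟨a, ha⟩ := exists_map_conj_le_of_mark_coset_ne_zero (right_ne_zero_of_mul h0)
        refine hLT ?_
        have h1 := hTc _ (hT M (hm0 M hM) _ ha) a⁻¹
        rwa [map_conj_inv_map_conj] at h1
      -- The difference vanishes at order `n`, where the layer was built to agree with `m`, and
      -- above `n`, where both terms are zero.
      obtain ⟨b, hb, hb'⟩ := ih (fun L => m L - mark L (layer n m))
        (fun L a => by rw [hm, mark_map_conj])
        (fun L hL => by
          by_cases h0 : m L = 0
          · refine hsupp L fun h1 => hL ?_
            rw [h0, h1, sub_zero]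
          · exact hm0 L h0)
        (fun L hL => by
          by_contra hlt
          refine hL ?_
          rcases (not_lt.1 hlt).eq_or_lt with h1 | h1
          · rw [mark_layer_of_card_eq hm h1.symm, sub_self]
          · have h2 : m L = 0 := by
              by_contra h2
              exact absurd (hn L h2) (by omega)
            rw [mark_layer_of_card_gt m h1, h2, sub_zero])
      refine ⟨layer n m + b, Submodule.add_mem _ hmem hb, fun L => ?_⟩
      rw [map_add, hb']
      ring
  exact key (Nat.card (G × H) + 1) m hm hm0
    fun L _ => Nat.lt_succ_of_le (Subgroup.card_le_card_group L)

end


/-! ### Marks indexed by pairs of homomorphisms -/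

section

variable {G H K G' H' : Type u} [Group G] [Group H] [Group K] [Group G'] [Group H']
variable {W W' : Type u} [Group W] [Group W']

/-- The mark at the subgroup `{(α(w), β(w)) | w ∈ W}`. -/
def pairMark (α : W →* G) (β : W →* H) : QB G H →ₗ[ℚ] ℚ :=
  mark (α.prod β).range

/-- The condition `α(w) x = x β(w)` involves `α` and `β` separately. With a free parameter group
`W`, restrictions and products then act on marks by composing homomorphisms. -/
theorem pairMark_cls (α : W →* G) (β : W →* H) (X : Biset G H) :
    pairMark α β (cls X) =
      Nat.card {x : X.carrier // ∀ w, α w • x = MulOpposite.op (β w) • x} := by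
  rw [pairMark, mark_cls]
  congr 1
  refine Nat.card_congr (Equiv.subtypeEquivRight fun x => ?_)
  rw [Biset.mem_fixedPoints]
  simp only [MonoidHom.mem_range, forall_exists_index, forall_apply_eq_imp_iff]
  refine forall_congr' fun w => ?_
  rw [Biset.prod_smul_def, smul_comm, MulOpposite.op_inv, inv_smul_eq_iff]
  rfl

/-- Taking `W = L` shows that every mark is a pair mark, so `ext_mark` applies to identities proved
for pair marks. -/
theorem mark_eq_pairMark (L : Subgroup (G × H)) :
    mark L = pairMark ((MonoidHom.fst G H).comp L.subtype)
      ((MonoidHom.snd G H).comp L.subtype) := by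
  rw [pairMark]
  congr 1
  ext x
  simp only [MonoidHom.mem_range]
  exact ⟨fun h => ⟨⟨x, h⟩, rfl⟩, by rintro ⟨y, rfl⟩; exact y.2⟩

theorem prod_range_map_conj (α : W →* G) (β : W →* H) (a : G × H) :
    (α.prod β).range.map (MulAut.conj a).toMonoidHom =
      (((MulAut.conj a.1).toMonoidHom.comp α).prod
        ((MulAut.conj a.2).toMonoidHom.comp β)).range := by
  rw [MonoidHom.map_range]
  congr 1

theorem pairMark_conj (α : W →* G) (β : W →* H) (s : G) (t : H) :
    pairMark ((MulAut.conj s).toMonoidHom.comp α) ((MulAut.conj t).toMonoidHom.comp β) =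
      pairMark α β := by
  rw [pairMark, ← prod_range_map_conj α β (s, t), mark_map_conj]
  rfl

theorem pairMark_conj_left (α : W →* G) (β : W →* H) (s : G) :
    pairMark ((MulAut.conj s).toMonoidHom.comp α) β = pairMark α β := by
  rw [← pairMark_conj α β s 1]
  congr
  ext w
  simp

theorem pairMark_conj_right (α : W →* G) (β : W →* H) (s : H) :
    pairMark α ((MulAut.conj s).toMonoidHom.comp β) = pairMark α β := by
  rw [← pairMark_conj α β 1 s]
  congr
  ext w
  simp

theorem pairMark_restrict (σ : G' →* G) (τ : H' →* H) (α : W →* G') (β : W →* H')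
    (a : QB G H) :
    pairMark α β (restrict σ τ a) = pairMark (σ.comp α) (τ.comp β) a := by
  revert a
  refine DFunLike.congr_fun (f := pairMark α β ∘ₗ restrict σ τ) (linearMap_ext_cls fun X => ?_)
  rw [LinearMap.comp_apply, restrict_cls, pairMark_cls, pairMark_cls]
  rfl

theorem pairMark_extProd (α : W →* G × G') (β : W →* H × H') (a : QB G H) (b : QB G' H') :
    pairMark α β (extProd a b) =
      pairMark ((MonoidHom.fst G G').comp α) ((MonoidHom.fst H H').comp β) a *
        pairMark ((MonoidHom.snd G G').comp α) ((MonoidHom.snd H H').comp β) b := by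
  revert b
  refine DFunLike.congr_fun (f := pairMark α β ∘ₗ extProd a)
    (g := pairMark ((MonoidHom.fst G G').comp α) ((MonoidHom.fst H H').comp β) a •
        pairMark ((MonoidHom.snd G G').comp α) ((MonoidHom.snd H H').comp β))
    (linearMap_ext_cls fun Y => ?_)
  revert a
  refine DFunLike.congr_fun (f := pairMark α β ∘ₗ extProd.flip (cls Y))
    (g := (pairMark ((MonoidHom.fst G G').comp α) ((MonoidHom.fst H H').comp β)).smulRight
        (pairMark ((MonoidHom.snd G G').comp α) ((MonoidHom.snd H H').comp β) (cls Y)))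
    (linearMap_ext_cls fun X => ?_)
  rw [LinearMap.comp_apply, LinearMap.flip_apply, extProd_cls, LinearMap.smulRight_apply,
    smul_eq_mul, pairMark_cls, pairMark_cls, pairMark_cls, ← Nat.cast_mul, ← Nat.card_prod]
  congr 1
  refine Nat.card_congr ((Equiv.subtypeEquivRight fun x => ?_).trans Equiv.subtypeProdEquivProd)
  exact (forall_congr' fun w => Prod.ext_iff).trans forall_and

/-! ### Marks of tensor products -/

/-- By freeness, `X × Y → X ×_H Y` has all fibres of size |H|. The class of `(x, y)` is fixed when
each `w` admits some `h` with `α(w) x = x h` and `h y = y γ(w)`. Freeness makes `h` unique, hence a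
homomorphism `θ` of `w`, and the pairs are sorted by `θ`. -/
theorem card_fixed_tensor (X : Biset G H) (Y : Biset H K)
    (hfree : ∀ (x : X.carrier) (y : Y.carrier) (h : H),
      MulOpposite.op h • x = x → h • y = y → h = 1)
    (α : W →* G) (γ : W →* K) :
    Nat.card H * Nat.card {z : (X.tensor Y).carrier // ∀ w, α w • z = MulOpposite.op (γ w) • z} =
      Nat.card (Σ θ : W →* H, {x : X.carrier // ∀ w, α w • x = MulOpposite.op (θ w) • x} ×
        {y : Y.carrier // ∀ w, θ w • y = MulOpposite.op (γ w) • y}) := by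
  have hinj : ∀ (x : X.carrier) (y : Y.carrier) (h k : H),
      MulOpposite.op h⁻¹ • x = MulOpposite.op k⁻¹ • x → h • y = k • y → h = k := by
    intro x y h k h1 h2
    refine (inv_mul_eq_one.1 (hfree x y (k⁻¹ * h) ?_ ?_)).symm
    · rw [MulOpposite.op_mul, mul_smul, ← h1, MulOpposite.op_inv, smul_inv_smul]
    · rw [mul_smul, h2, inv_smul_smul]
  have huniq : ∀ (x : X.carrier) (y : Y.carrier) (w : W) (h k : H),
      α w • x = MulOpposite.op h • x → h • y = MulOpposite.op (γ w) • y →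
      α w • x = MulOpposite.op k • x → k • y = MulOpposite.op (γ w) • y → h = k := by
    intro x y w h k h1 h2 k1 k2
    have k3 : k⁻¹ • y = (MulOpposite.op (γ w))⁻¹ • y := by
      rw [inv_smul_eq_iff, smul_comm, k2, inv_smul_smul]
    refine mul_inv_eq_one.1 (hfree x y (h * k⁻¹) ?_ ?_)
    · rw [MulOpposite.op_mul, mul_smul, ← h1, k1, MulOpposite.op_inv, inv_smul_smul]
    · rw [mul_smul, k3, smul_comm, h2, inv_smul_smul]
  let q : X.carrier × Y.carrier → (X.tensor Y).carrier := Quotient.mk (Biset.tensorSetoid X Y)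
  have hq : ∀ a b, q a = q b ↔ ∃ h : H, b = (MulOpposite.op h⁻¹ • a.1, h • a.2) :=
    fun a b => Quotient.eq (r := Biset.tensorSetoid X Y)
  have hq' : Function.Surjective q := Quotient.mk_surjective
  have hfix : ∀ a w, (α w • q a = MulOpposite.op (γ w) • q a ↔
      ∃ h : H, α w • a.1 = MulOpposite.op h • a.1 ∧ h • a.2 = MulOpposite.op (γ w) • a.2) := by
    intro a w
    refine (hq (α w • a.1, a.2) (a.1, MulOpposite.op (γ w) • a.2)).trans
      (exists_congr fun h => ?_)
    rw [Prod.mk.injEq, MulOpposite.op_inv, eq_inv_smul_iff]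
    exact and_congr eq_comm eq_comm
  let A := {z : (X.tensor Y).carrier // ∀ w, α w • z = MulOpposite.op (γ w) • z}
  let B := {a : X.carrier × Y.carrier // ∀ w, α w • q a = MulOpposite.op (γ w) • q a}
  -- A section of the quotient map, translated by `H`, trivialises the fibres over the fixed
  -- classes.
  have h1 : Nat.card (H × A) = Nat.card B := by
    have hqh : ∀ (h : H) a, q (MulOpposite.op h⁻¹ • a.1, h • a.2) = q a :=
      fun h a => ((hq a _).2 ⟨h, rfl⟩).symm
    let f : H × A → B := fun c =>
      ⟨(MulOpposite.op c.1⁻¹ • (Function.surjInv hq' c.2.1).1,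
        c.1 • (Function.surjInv hq' c.2.1).2), by
        rw [hqh, Function.surjInv_eq hq']
        exact c.2.2⟩
    refine Nat.card_congr (Equiv.ofBijective f ⟨?_, ?_⟩)
    · rintro ⟨h, z⟩ ⟨h', z'⟩ he
      have he' := congrArg Subtype.val he
      have hz : z = z' := by
        have := congrArg q he'
        simp only [f] at this
        rw [hqh, hqh, Function.surjInv_eq hq', Function.surjInv_eq hq'] at this
        exact Subtype.ext this
      subst hz
      rw [hinj _ _ h h' (congrArg Prod.fst he') (congrArg Prod.snd he')]
    · rintro ⟨a, ha⟩
      obtain ⟨h, hh⟩ := (hq (Function.surjInv hq' (q a)) a).1 (Function.surjInv_eq hq' (q a))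
      exact ⟨(h, ⟨q a, ha⟩), Subtype.ext hh.symm⟩
  rw [← Nat.card_prod]
  refine h1.trans (Nat.card_congr (Equiv.ofBijective
    (fun c => (⟨(c.2.1.1, c.2.2.1), fun w =>
      (hfix _ w).2 ⟨c.1 w, c.2.1.2 w, c.2.2.2 w⟩⟩ : B)) ⟨?_, ?_⟩).symm)
  · rintro ⟨θ, ⟨x, hx⟩, ⟨y, hy⟩⟩ ⟨θ', ⟨x', hx'⟩, ⟨y', hy'⟩⟩ he
    obtain ⟨rfl, rfl⟩ := Prod.mk.inj (congrArg Subtype.val he)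
    have hθ : θ = θ' := MonoidHom.ext fun w => huniq _ _ w _ _ (hx w) (hy w) (hx' w) (hy' w)
    subst hθ
    rfl
  · rintro ⟨⟨x, y⟩, ha⟩
    choose t ht1 ht2 using fun w => (hfix (x, y) w).1 (ha w)
    refine ⟨⟨MonoidHom.mk' t fun w w' => ?_, ⟨x, ht1⟩, ⟨y, ht2⟩⟩, rfl⟩
    refine huniq x y (w * w') _ _ (ht1 _) (ht2 _) ?_ ?_
    · rw [map_mul, mul_smul, ht1 w', smul_comm, ht1 w, MulOpposite.op_mul, mul_smul]
    · rw [map_mul, mul_smul, ht2 w', smul_comm, ht2 w, MulOpposite.op_mul, mul_smul]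

variable (G H) in
/-- The span of the bisets with free left action. -/
def leftFree : Submodule ℚ (QB G H) :=
  Submodule.span ℚ (cls '' {X : Biset G H | ∀ (x : X.carrier) (g : G), g • x = x → g = 1})

variable (G H) in
/-- The span of the bisets with free right action. -/
def rightFree : Submodule ℚ (QB G H) :=
  Submodule.span ℚ
    (cls '' {X : Biset G H | ∀ (x : X.carrier) (h : H), MulOpposite.op h • x = x → h = 1})

theorem pairMark_dot_cls [Finite H] [Fintype (W →* H)] (X : Biset G H) (Y : Biset H K)
    (hfree : ∀ (x : X.carrier) (y : Y.carrier) (h : H),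
      MulOpposite.op h • x = x → h • y = y → h = 1)
    (α : W →* G) (γ : W →* K) :
    (Nat.card H : ℚ) * pairMark α γ (dot (cls X) (cls Y)) =
      ∑ θ : W →* H, pairMark α θ (cls X) * pairMark θ γ (cls Y) := by
  rw [dot_cls, pairMark_cls, ← Nat.cast_mul, card_fixed_tensor X Y hfree, Nat.card_sigma,
    Nat.cast_sum]
  refine Finset.sum_congr rfl fun θ _ => ?_
  rw [pairMark_cls, pairMark_cls, Nat.card_prod, Nat.cast_mul]

theorem pairMark_dot_of_span [Finite H] [Fintype (W →* H)] {A : Set (Biset G H)}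
    {B : Set (Biset H K)}
    (hfree : ∀ X ∈ A, ∀ Y ∈ B, ∀ (x : X.carrier) (y : Y.carrier) (h : H),
      MulOpposite.op h • x = x → h • y = y → h = 1)
    (α : W →* G) (γ : W →* K) {a : QB G H} {b : QB H K} (ha : a ∈ Submodule.span ℚ (cls '' A))
    (hb : b ∈ Submodule.span ℚ (cls '' B)) :
    (Nat.card H : ℚ) * pairMark α γ (dot a b) =
      ∑ θ : W →* H, pairMark α θ a * pairMark θ γ b := by
  induction ha, hb using Submodule.span_induction₂ with
  | mem_mem x y hx hy =>
    obtain ⟨X, hX, rfl⟩ := hx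
    obtain ⟨Y, hY, rfl⟩ := hy
    exact pairMark_dot_cls X Y (hfree X hX Y hY) α γ
  | zero_left y _ => simp
  | zero_right x _ => simp
  | add_left x y z _ _ _ hx hy =>
    simp only [map_add, LinearMap.add_apply, mul_add, add_mul, Finset.sum_add_distrib, hx, hy]
  | add_right x y z _ _ _ hx hy =>
    simp only [map_add, mul_add, Finset.sum_add_distrib, hx, hy]
  | smul_left r x y _ _ hx =>
    simp only [map_smul, LinearMap.smul_apply, smul_eq_mul, mul_left_comm _ r, mul_assoc, hx,
      Finset.mul_sum]
  | smul_right r x y _ _ hx =>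
    simp only [map_smul, smul_eq_mul, mul_left_comm _ r, hx, Finset.mul_sum]

theorem pairMark_dot_of_mem_leftFree [Finite H] [Fintype (W →* H)] (α : W →* G) (γ : W →* K)
    (a : QB G H) {b : QB H K} (hb : b ∈ leftFree H K) :
    (Nat.card H : ℚ) * pairMark α γ (dot a b) =
      ∑ θ : W →* H, pairMark α θ a * pairMark θ γ b :=
  pairMark_dot_of_span (A := Set.univ)
    (B := {Y | ∀ (y : Y.carrier) (h : H), h • y = y → h = 1})
    (fun _ _ _ hY _ y h _ hy => hY y h hy) α γ
    (by rw [Set.image_univ, span_cls_eq_top]; exact Submodule.mem_top) hb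

theorem pairMark_dot_of_mem_rightFree [Finite H] [Fintype (W →* H)] (α : W →* G) (γ : W →* K)
    {a : QB G H} (b : QB H K) (ha : a ∈ rightFree G H) :
    (Nat.card H : ℚ) * pairMark α γ (dot a b) =
      ∑ θ : W →* H, pairMark α θ a * pairMark θ γ b :=
  pairMark_dot_of_span (B := Set.univ)
    (A := {X | ∀ (x : X.carrier) (h : H), MulOpposite.op h • x = x → h = 1})
    (fun _ hX _ _ x _ h hx _ => hX x h hx) α γ ha
    (by rw [Set.image_univ, span_cls_eq_top]; exact Submodule.mem_top)

/-! ### The regular biset -/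

/-- A point `s` contributes at `θ` exactly when `θ` is `α` conjugated by `s⁻¹`. So the sum runs over
`s` in `G`, and `F` has the same value at all these conjugates. -/
theorem sum_pairMark_regular_mul [Finite G] [Fintype (W →* G)] (α : W →* G) (F : (W →* G) → ℚ)
    (hF : ∀ s : G, F ((MulAut.conj s).toMonoidHom.comp α) = F α) :
    ∑ θ : W →* G, pairMark α θ (cls (Biset.regular G)) * F θ = Nat.card G * F α := by
  have key : ∀ θ : W →* G, pairMark α θ (cls (Biset.regular G)) * F θ =
      Nat.card {s : G // (MulAut.conj s⁻¹).toMonoidHom.comp α = θ} * F α := by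
    intro θ
    have h : Nat.card {x : (Biset.regular G).carrier // ∀ w, α w • x = MulOpposite.op (θ w) • x} =
        Nat.card {s : G // (MulAut.conj s⁻¹).toMonoidHom.comp α = θ} := by
      refine Nat.card_congr (Equiv.subtypeEquivRight fun (s : G) => ?_)
      rw [DFunLike.ext_iff]
      refine forall_congr' fun w => ?_
      change α w * s = s * θ w ↔ s⁻¹ * α w * s⁻¹⁻¹ = θ w
      rw [inv_inv, mul_assoc, inv_mul_eq_iff_eq_mul]
    rw [pairMark_cls, h]
    by_cases h0 : ∃ s : G, (MulAut.conj s⁻¹).toMonoidHom.comp α = θ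
    · obtain ⟨s, rfl⟩ := h0
      rw [hF]
    · have : IsEmpty {s : G // (MulAut.conj s⁻¹).toMonoidHom.comp α = θ} :=
        ⟨fun s => h0 ⟨s.1, s.2⟩⟩
      rw [Nat.card_of_isEmpty, Nat.cast_zero, zero_mul, zero_mul]
  rw [Finset.sum_congr rfl fun θ _ => key θ, ← Finset.sum_mul, ← Nat.cast_sum, ← Nat.card_sigma]
  congr 2
  exact Nat.card_congr (Equiv.sigmaFiberEquiv _)

theorem pairMark_regular_comm [Finite G] (α β : W →* G) :
    pairMark α β (cls (Biset.regular G)) = pairMark β α (cls (Biset.regular G)) := by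
  rw [pairMark_cls, pairMark_cls]
  congr 1
  refine Nat.card_congr (Equiv.subtypeEquiv (Equiv.inv G) fun (s : G) => forall_congr' fun w => ?_)
  change α w * s = s * β w ↔ β w * s⁻¹ = s⁻¹ * α w
  rw [mul_inv_eq_iff_eq_mul, mul_assoc, eq_inv_mul_iff_mul_eq]
  exact eq_comm

/-! ### Bifree elements -/

/-- Twisted diagonal means that both projections are injective on `L`. In this form, stability under
subgroups and conjugation is immediate. -/
theorem mem_twistedDiagonals_iff {L : Subgroup (G × H)} :
    L ∈ twistedDiagonals G H ↔ ∀ a ∈ L, a.1 = 1 ↔ a.2 = 1 := by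
  constructor
  · rintro ⟨V, φ, hφ, rfl⟩ _ ⟨v, rfl⟩
    change φ v = 1 ↔ (v : H) = 1
    rw [map_eq_one_iff φ hφ, OneMemClass.coe_eq_one]
  · intro h
    have h2 : Function.Injective ((MonoidHom.snd G H).subgroupMap L) := by
      rw [injective_iff_map_eq_one]
      rintro ⟨a, ha⟩ ha1
      have h2 : a.2 = 1 := congrArg Subtype.val ha1
      exact Subtype.ext (Prod.ext ((h a ha).2 h2) h2)
    let e := MulEquiv.ofBijective ((MonoidHom.snd G H).subgroupMap L)
      ⟨h2, (MonoidHom.snd G H).subgroupMap_surjective L⟩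
    have he : ∀ v, (e.symm v).1.2 = v := fun v => congrArg Subtype.val (e.apply_symm_apply v)
    refine ⟨L.map (MonoidHom.snd G H),
      ((MonoidHom.fst G H).comp L.subtype).comp e.symm.toMonoidHom, ?_, ?_⟩
    · rw [injective_iff_map_eq_one]
      intro v hv
      have hv1 : (e.symm v).1.1 = 1 := hv
      exact Subtype.ext ((he v).symm.trans ((h _ (e.symm v).2).1 hv1))
    · ext a
      constructor
      · intro ha
        refine ⟨e ⟨a, ha⟩, Prod.ext ?_ rfl⟩
        change (e.symm (e ⟨a, ha⟩)).1.1 = a.1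
        rw [e.symm_apply_apply]
      · rintro ⟨v, rfl⟩
        have hv : (((MonoidHom.fst G H).comp L.subtype).comp e.symm.toMonoidHom v, (v : H)) =
            (e.symm v).1 := Prod.ext rfl (he v).symm
        change (((MonoidHom.fst G H).comp L.subtype).comp e.symm.toMonoidHom v, (v : H)) ∈ L
        rw [hv]
        exact (e.symm v).2

theorem mem_twistedDiagonals_of_le {L M : Subgroup (G × H)} (hL : L ∈ twistedDiagonals G H)
    (h : M ≤ L) : M ∈ twistedDiagonals G H :=
  mem_twistedDiagonals_iff.2 fun a ha => mem_twistedDiagonals_iff.1 hL a (h ha)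

theorem map_conj_mem_twistedDiagonals_iff {L : Subgroup (G × H)} {b : G × H} :
    L.map (MulAut.conj b).toMonoidHom ∈ twistedDiagonals G H ↔ L ∈ twistedDiagonals G H := by
  rw [mem_twistedDiagonals_iff, mem_twistedDiagonals_iff]
  simp only [Subgroup.mem_map, forall_exists_index, and_imp, forall_apply_eq_imp_iff₂]
  refine forall₂_congr fun a _ => ?_
  change (b.1 * a.1 * b.1⁻¹ = 1 ↔ b.2 * a.2 * b.2⁻¹ = 1) ↔ _
  rw [conj_eq_one_iff, conj_eq_one_iff]

variable [Finite G] [Finite H]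

theorem coset_smul_eq_self {L : Subgroup (G × H)} {a : G × H} {y : (Biset.coset L).carrier}
    (h : a • y = y) : ∃ b : G × H, b⁻¹ * a * b ∈ L := by
  have h' := (Biset.coset_smul L a y).symm.trans h
  obtain ⟨b, rfl⟩ := QuotientGroup.mk_surjective (s := L) y
  have h1 : ((a * b : G × H) : (G × H) ⧸ L) = (b : G × H) := h'
  rw [eq_comm, QuotientGroup.eq] at h1
  exact ⟨b, by rwa [mul_assoc]⟩

theorem bifree_le_leftFree : bifree G H ≤ leftFree G H := by
  refine Submodule.span_le.2 ?_
  rintro _ ⟨L, hL, rfl⟩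
  refine Submodule.subset_span ⟨_, fun y g hg => ?_, rfl⟩
  rw [Biset.left_smul_eq] at hg
  obtain ⟨b, hb⟩ := coset_smul_eq_self hg
  have := (mem_twistedDiagonals_iff.1 hL _ hb).2 (by simp)
  simpa [mul_assoc, inv_mul_eq_one] using this

theorem bifree_le_rightFree : bifree G H ≤ rightFree G H := by
  refine Submodule.span_le.2 ?_
  rintro _ ⟨L, hL, rfl⟩
  refine Submodule.subset_span ⟨_, fun y g hg => ?_, rfl⟩
  rw [Biset.right_smul_eq] at hg
  obtain ⟨b, hb⟩ := coset_smul_eq_self hg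
  have := (mem_twistedDiagonals_iff.1 hL _ hb).1 (by simp)
  simpa [mul_assoc, inv_mul_eq_one] using this

theorem mem_twistedDiagonals_of_mark_ne_zero {a : QB G H} (ha : a ∈ bifree G H)
    {L : Subgroup (G × H)} (h : mark L a ≠ 0) : L ∈ twistedDiagonals G H := by
  contrapose! h
  have h' : bifree G H ≤ LinearMap.ker (mark L) := by
    refine Submodule.span_le.2 ?_
    rintro _ ⟨M, hM, rfl⟩
    rw [SetLike.mem_coe, LinearMap.mem_ker]
    by_contra h0
    obtain ⟨b, hb⟩ := exists_map_conj_le_of_mark_coset_ne_zero h0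
    exact h (map_conj_mem_twistedDiagonals_iff.1 (mem_twistedDiagonals_of_le hM hb))
  exact h' ha

end

/-! ### Frobenius elements in terms of marks -/

section

variable {S : Type u} [Group S] [Finite S] {a : QB S S}

/-- In the product formula the regular factor restricts `θ` to conjugates of the second component of
`α`, and the other factors are conjugation invariant, so the sum collapses to one product. -/
theorem pairMark_dot_left_restrict_regular {W : Type u} [Group W] [Finite W]
    (ha : a ∈ leftFree S S) (α : W →* S × S) (γ : W →* S) :
    pairMark α γ
        (dot (restrict (MonoidHom.id (S × S)) (diag S) (extProd a (cls (Biset.regular S)))) a) =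
      pairMark ((MonoidHom.fst S S).comp α) ((MonoidHom.snd S S).comp α) a *
        pairMark ((MonoidHom.snd S S).comp α) γ a := by
  have : Finite (W →* S) := .of_injective _ DFunLike.coe_injective
  have := Fintype.ofFinite (W →* S)
  have h := pairMark_dot_of_mem_leftFree α γ
    (restrict (MonoidHom.id (S × S)) (diag S) (extProd a (cls (Biset.regular S)))) ha
  have h2 := sum_pairMark_regular_mul ((MonoidHom.snd S S).comp α)
    (fun θ => pairMark ((MonoidHom.fst S S).comp α) θ a * pairMark θ γ a)
    (fun s => by rw [pairMark_conj_left, pairMark_conj_right])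
  refine mul_left_cancel₀ (Nat.cast_ne_zero.2 (Nat.card_pos (α := S)).ne') ((h.trans ?_).trans h2)
  refine Finset.sum_congr rfl fun θ _ => ?_
  rw [pairMark_restrict, pairMark_extProd]
  change pairMark ((MonoidHom.fst S S).comp α) θ a * pairMark ((MonoidHom.snd S S).comp α) θ _ *
    _ = _
  ring

theorem pairMark_dot_right_restrict_regular {W : Type u} [Group W] [Finite W]
    (ha : a ∈ rightFree S S) (α : W →* S) (γ : W →* S × S) :
    pairMark α γ
        (dot a (restrict (diag S) (MonoidHom.id (S × S)) (extProd a (cls (Biset.regular S))))) =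
      pairMark α ((MonoidHom.snd S S).comp γ) a *
        pairMark ((MonoidHom.snd S S).comp γ) ((MonoidHom.fst S S).comp γ) a := by
  have : Finite (W →* S) := .of_injective _ DFunLike.coe_injective
  have := Fintype.ofFinite (W →* S)
  have h := pairMark_dot_of_mem_rightFree α γ
    (restrict (diag S) (MonoidHom.id (S × S)) (extProd a (cls (Biset.regular S)))) ha
  have h2 := sum_pairMark_regular_mul ((MonoidHom.snd S S).comp γ)
    (fun θ => pairMark α θ a * pairMark θ ((MonoidHom.fst S S).comp γ) a)
    (fun s => by rw [pairMark_conj_left, pairMark_conj_right])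
  refine mul_left_cancel₀ (Nat.cast_ne_zero.2 (Nat.card_pos (α := S)).ne') ((h.trans ?_).trans h2)
  refine Finset.sum_congr rfl fun θ _ => ?_
  -- Here `θ` sits on the left of the regular mark, so its symmetry is needed before the sum can
  -- collapse.
  rw [pairMark_restrict, pairMark_extProd, pairMark_regular_comm ((MonoidHom.snd S S).comp γ)]
  change _ * (pairMark θ ((MonoidHom.fst S S).comp γ) a *
    pairMark θ ((MonoidHom.snd S S).comp γ) _) = _
  ring

theorem isRightFrobenius_iff (ha : a ∈ leftFree S S) :
    IsRightFrobenius a ↔ ∀ (W : Type u) [Group W] [Finite W] (α₁ α₂ γ : W →* S),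
      pairMark α₁ γ a * pairMark α₂ γ a = pairMark α₁ α₂ a * pairMark α₂ γ a := by
  constructor
  · intro h W _ _ α₁ α₂ γ
    have h' := congrArg (pairMark (α₁.prod α₂) γ) h
    rw [pairMark_dot_left_restrict_regular ha, pairMark_restrict, pairMark_extProd] at h'
    exact h'
  · intro h
    refine ext_mark fun L => ?_
    rw [mark_eq_pairMark, pairMark_dot_left_restrict_regular ha, pairMark_restrict,
      pairMark_extProd]
    exact h _ _ _ _

theorem isLeftFrobenius_iff (ha : a ∈ rightFree S S) :
    IsLeftFrobenius a ↔ ∀ (W : Type u) [Group W] [Finite W] (α γ₁ γ₂ : W →* S),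
      pairMark α γ₁ a * pairMark α γ₂ a = pairMark α γ₂ a * pairMark γ₂ γ₁ a := by
  constructor
  · intro h W _ _ α γ₁ γ₂
    have h' := congrArg (pairMark α (γ₁.prod γ₂)) h
    rw [pairMark_dot_right_restrict_regular ha, pairMark_restrict, pairMark_extProd] at h'
    exact h'
  · intro h
    refine ext_mark fun L => ?_
    rw [mark_eq_pairMark, pairMark_dot_right_restrict_regular ha, pairMark_restrict,
      pairMark_extProd]
    exact h _ _ _ _

end


/-! ### Graphs of homomorphisms -/

section

variable {G H : Type u} [Group G] [Group H]

theorem mem_graph {V : Subgroup H} {φ : V →* G} {a : G × H} :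
    a ∈ graph V φ ↔ ∃ h : a.2 ∈ V, φ ⟨a.2, h⟩ = a.1 := by
  constructor
  · rintro ⟨v, rfl⟩
    exact ⟨v.2, rfl⟩
  · rintro ⟨h, h'⟩
    exact ⟨⟨a.2, h⟩, Prod.ext h' rfl⟩

theorem graph_map_snd (V : Subgroup H) (φ : V →* G) :
    (graph V φ).map (MonoidHom.snd G H) = V := by
  rw [graph, MonoidHom.map_range, MonoidHom.snd_comp_prod, Subgroup.range_subtype]

theorem graph_injective (V : Subgroup H) : Function.Injective (graph V : (V →* G) → _) := by
  intro φ ψ h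
  ext v
  have h1 : (φ v, (v : H)) ∈ graph V ψ := h ▸ ⟨v, rfl⟩
  exact (mem_graph.1 h1).2.symm

theorem eq_graph_of_le {V : Subgroup H} {φ : V →* G} {M : Subgroup (G × H)}
    (h : M ≤ graph V φ) :
    ∃ h' : M.map (MonoidHom.snd G H) ≤ V,
      M = graph (M.map (MonoidHom.snd G H)) (φ.comp (Subgroup.inclusion h')) := by
  refine ⟨(Subgroup.map_mono h).trans_eq (graph_map_snd V φ), ?_⟩
  ext a
  rw [mem_graph]
  constructor
  · intro ha
    exact ⟨⟨a, ha, rfl⟩, (mem_graph.1 (h ha)).2⟩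
  · rintro ⟨⟨b, hb, hab⟩, h2⟩
    have hab : b.2 = a.2 := hab
    obtain ⟨h3, h4⟩ := mem_graph.1 (h hb)
    have : b = a := by
      refine Prod.ext (h4.symm.trans (Eq.trans ?_ h2)) hab
      exact congrArg φ (Subtype.ext hab)
    exact this ▸ hb

end

/-! ### Fusion systems as sets of graphs -/

variable {S : Type u} [Group S]

theorem diagonal_eq_graph : diagonal S = graph ⊤ (⊤ : Subgroup S).subtype := by
  ext a
  rw [mem_graph]
  constructor
  · rintro ⟨s, rfl⟩
    exact ⟨trivial, rfl⟩
  · rintro ⟨_, h⟩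
    exact ⟨a.2, Prod.ext h rfl⟩

theorem mem_diagonal {a : S × S} : a ∈ diagonal S ↔ a.1 = a.2 := by
  constructor
  · rintro ⟨s, rfl⟩
    rfl
  · intro h
    exact ⟨a.1, Prod.ext rfl h⟩

namespace FusionSystem

variable (F : FusionSystem S)

theorem inclusion_mem {P Q : Subgroup S} (h : P ≤ Q) : Subgroup.inclusion h ∈ F.Hom P Q :=
  F.conj_mem 1 _ fun u => by simp

/-- Whether `φ` is a morphism does not depend on its codomain: a morphism into `S` factors as an
isomorphism onto its image, a morphism by `iso_mem`, and the inclusion of that image into `Q`. -/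
theorem mem_hom_iff {P Q : Subgroup S} {φ : P →* Q} :
    φ ∈ F.Hom P Q ↔ graph P (Q.subtype.comp φ) ∈ F.system := by
  constructor
  · intro h
    exact ⟨P, (Subgroup.inclusion le_top).comp φ, F.comp_mem h (F.inclusion_mem le_top), rfl⟩
  · rintro ⟨P', φ', h, he⟩
    obtain rfl : P = P' := by
      rw [← graph_map_snd P (Q.subtype.comp φ), he, graph_map_snd]
    have he' := graph_injective _ he
    let e : P ≃* (φ'.range.map (⊤ : Subgroup S).subtype : Subgroup S) :=
      (MonoidHom.ofInjective (F.injective h)).trans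
        (Subgroup.equivMapOfInjective _ _ (Subgroup.subtype_injective _))
    have hle : φ'.range.map (⊤ : Subgroup S).subtype ≤ Q := by
      rw [MonoidHom.map_range, ← he']
      rintro _ ⟨u, rfl⟩
      exact (φ u).2
    have h1 := F.comp_mem (F.iso_mem h e fun _ => rfl).1 (F.inclusion_mem hle)
    convert h1
    ext u
    exact DFunLike.congr_fun he' u

theorem system_subset : F.system ⊆ twistedDiagonals S S := by
  rintro _ ⟨P, φ, h, rfl⟩
  exact ⟨P, _, fun _ _ he => F.injective h (Subtype.ext he), rfl⟩

theorem mem_system_of_le {L M : Subgroup (S × S)} (hL : L ∈ F.system) (h : M ≤ L) :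
    M ∈ F.system := by
  obtain ⟨P, φ, hφ, rfl⟩ := hL
  obtain ⟨h', hM⟩ := eq_graph_of_le h
  rw [hM]
  exact ⟨_, φ.comp (Subgroup.inclusion h'), F.comp_mem (F.inclusion_mem h') hφ, rfl⟩

theorem star_mem_system {L M : Subgroup (S × S)} (hL : L ∈ F.system) (hM : M ∈ F.system) :
    star L M ∈ F.system := by
  obtain ⟨P, φ, hφ, rfl⟩ := hL
  obtain ⟨Q, ψ, hψ, rfl⟩ := hM
  set L := graph P ((⊤ : Subgroup S).subtype.comp φ) with hL
  set M := graph Q ((⊤ : Subgroup S).subtype.comp ψ) with hM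
  -- `R` is the set of `u` in `Q` with `ψ(u)` in `P`, the largest domain on which `φ ∘ ψ` makes
  -- sense.
  let R := (star L M).map (MonoidHom.snd S S)
  have hRQ : R ≤ Q := by
    rintro _ ⟨a, ⟨h, _, h2⟩, rfl⟩
    exact (mem_graph.1 h2).1
  have hRP : ∀ u : R, (⊤ : Subgroup S).subtype (ψ (Subgroup.inclusion hRQ u)) ∈ P := by
    rintro ⟨_, a, ⟨h, h1, h2⟩, rfl⟩
    obtain ⟨h3, h4⟩ := mem_graph.1 h2
    have h5 : h ∈ P := (mem_graph.1 h1).1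
    have h6 : _ = h := h4
    rw [← h6] at h5
    exact h5
  let ψ' : R →* P :=
    (((⊤ : Subgroup S).subtype.comp ψ).comp (Subgroup.inclusion hRQ)).codRestrict P hRP
  have hψ' : ψ' ∈ F.Hom R P := by
    rw [mem_hom_iff]
    refine F.mem_system_of_le (L := M) ⟨Q, ψ, hψ, rfl⟩ ?_
    rintro _ ⟨u, rfl⟩
    exact mem_graph.2 ⟨hRQ u.2, rfl⟩
  refine ⟨R, φ.comp ψ', F.comp_mem hψ' hφ, ?_⟩
  ext a
  rw [mem_graph]
  constructor
  · rintro ⟨h, h1, h2⟩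
    refine ⟨⟨a, ⟨h, h1, h2⟩, rfl⟩, ?_⟩
    obtain ⟨h3, h4⟩ := mem_graph.1 h1
    obtain ⟨h5, h6⟩ := mem_graph.1 h2
    refine Eq.trans ?_ h4
    change ((φ (ψ' _) : (⊤ : Subgroup S)) : S) = (φ _ : (⊤ : Subgroup S))
    congr 2
    exact Subtype.ext h6
  · rintro ⟨h, h1⟩
    refine ⟨ψ' ⟨a.2, h⟩, ?_, ?_⟩
    · exact mem_graph.2 ⟨(ψ' ⟨a.2, h⟩).2, h1⟩
    · exact mem_graph.2 ⟨hRQ h, rfl⟩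

theorem opposite_mem_system {L : Subgroup (S × S)} (hL : L ∈ F.system) :
    opposite L ∈ F.system := by
  obtain ⟨P, φ, h, rfl⟩ := hL
  let e : P ≃* (φ.range.map (⊤ : Subgroup S).subtype : Subgroup S) :=
    (MonoidHom.ofInjective (F.injective h)).trans
      (Subgroup.equivMapOfInjective _ _ (Subgroup.subtype_injective _))
  have h1 := F.mem_hom_iff.1 (F.iso_mem h e fun _ => rfl).2
  convert h1
  ext a
  change (a.2, a.1) ∈ graph _ _ ↔ _
  constructor
  · rintro ⟨u, hu⟩
    obtain ⟨h2, h3⟩ := Prod.mk.inj hu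
    refine ⟨e u, Prod.ext ?_ h2⟩
    change ((e.symm (e u) : P) : S) = a.1
    rw [e.symm_apply_apply]
    exact h3
  · rintro ⟨v, rfl⟩
    refine ⟨e.symm v, Prod.ext ?_ rfl⟩
    exact congrArg Subtype.val (e.apply_symm_apply v)

theorem graph_conj_mem_system (s : S) :
    graph ⊤ ((MulAut.conj s).toMonoidHom.comp (⊤ : Subgroup S).subtype) ∈ F.system :=
  ⟨⊤, ((MulAut.conj s).toMonoidHom.comp (⊤ : Subgroup S).subtype).codRestrict ⊤
    fun _ => trivial, F.conj_mem s _ fun _ => rfl, rfl⟩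

/-- Conjugating by `(s, t)` amounts to composing with the graph of conjugation by `s` on the left
and by `t⁻¹` on the right. -/
theorem map_conj_mem_system {L : Subgroup (S × S)} (hL : L ∈ F.system) (a : S × S) :
    L.map (MulAut.conj a).toMonoidHom ∈ F.system := by
  have h := F.star_mem_system (F.star_mem_system (F.graph_conj_mem_system a.1) hL)
    (F.graph_conj_mem_system a.2⁻¹)
  convert h
  ext b
  constructor
  · rintro ⟨c, hc, rfl⟩
    refine ⟨c.2, ⟨c.1, mem_graph.2 ⟨trivial, rfl⟩, hc⟩, mem_graph.2 ⟨trivial, ?_⟩⟩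
    change a.2⁻¹ * (a.2 * c.2 * a.2⁻¹) * a.2⁻¹⁻¹ = c.2
    group
  · rintro ⟨h, ⟨h', h1, h2⟩, h3⟩
    refine ⟨(h', h), h2, Prod.ext (mem_graph.1 h1).2 ?_⟩
    have h4 : a.2⁻¹ * b.2 * a.2⁻¹⁻¹ = h := (mem_graph.1 h3).2
    change a.2 * h * a.2⁻¹ = b.2
    rw [← h4]
    group

theorem diagonal_mem_system : diagonal S ∈ F.system := by
  rw [diagonal_eq_graph]
  exact ⟨⊤, MonoidHom.id _, F.conj_mem 1 _ fun u => by simp, rfl⟩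

end FusionSystem

theorem opposite_opposite {G H : Type u} [Group G] [Group H] (L : Subgroup (G × H)) :
    opposite (opposite L) = L := rfl

theorem image_opposite_eq_iff {T : Set (Subgroup (S × S))} :
    opposite '' T = T ↔ ∀ L ∈ T, opposite L ∈ T := by
  constructor
  · intro h L hL
    exact h ▸ ⟨L, hL, rfl⟩
  · intro h
    refine Set.Subset.antisymm ?_ fun L hL => ⟨opposite L, h L hL, opposite_opposite L⟩
    rintro _ ⟨L, hL, rfl⟩
    exact h L hL

theorem FusionSystem.system_mem_Sys (F : FusionSystem S) : F.system ∈ Sys S :=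
  ⟨F.system_subset, fun _ hL a => F.map_conj_mem_system hL a, fun _ hL _ h =>
    F.mem_system_of_le hL h, fun _ hL _ hM => F.star_mem_system hL hM, F.diagonal_mem_system,
    image_opposite_eq_iff.2 fun _ hL => F.opposite_mem_system hL⟩

theorem FusionSystem.system_injective :
    Function.Injective (FusionSystem.system : FusionSystem S → _) := by
  intro F F' h
  ext P Q φ
  rw [mem_hom_iff, mem_hom_iff, h]

/-- The fusion system whose morphisms are the homomorphisms with graph in `T`. -/
def FusionSystem.ofSystem {T : Set (Subgroup (S × S))} (hT : T ∈ Sys S) : FusionSystem S where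
  Hom P Q := {φ | graph P (Q.subtype.comp φ) ∈ T}
  comp_mem {P Q R φ ψ} hφ hψ := by
    change graph P (R.subtype.comp (ψ.comp φ)) ∈ T
    convert hT.2.2.2.1 _ hψ _ hφ
    ext a
    constructor
    · rintro ⟨u, rfl⟩
      exact ⟨φ u, ⟨φ u, rfl⟩, ⟨u, rfl⟩⟩
    · rintro ⟨h, h1, h2⟩
      obtain ⟨h3, h4⟩ := mem_graph.1 h1
      obtain ⟨h5, h6⟩ := mem_graph.1 h2
      refine mem_graph.2 ⟨h5, Eq.trans ?_ h4⟩
      change ((ψ _ : R) : S) = ψ _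
      congr 2
      exact Subtype.ext h6
  conj_mem {P Q} s φ h := by
    -- The graph of conjugation by `s` lies in the conjugate of Δ(S) by `(s, 1)`.
    refine hT.2.2.1 _ (hT.2.1 _ hT.2.2.2.2.1 (s, 1)) _ ?_
    rintro _ ⟨u, rfl⟩
    refine ⟨(u, u), mem_diagonal.2 rfl, Prod.ext (h u).symm ?_⟩
    change (1 : S) * u * 1⁻¹ = u
    simp
  injective {P Q φ} h := by
    obtain ⟨V, ψ, hψ, he⟩ := hT.1 h
    obtain rfl : P = V := by
      rw [← graph_map_snd P (Q.subtype.comp φ), he, graph_map_snd]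
    rw [← graph_injective _ he] at hψ
    exact fun _ _ hx => hψ (congrArg Subtype.val hx)
  iso_mem {P Q φ} h e he := by
    constructor
    · have h1 : (φ.range.map Q.subtype).subtype.comp e.toMonoidHom = Q.subtype.comp φ :=
        MonoidHom.ext he
      change graph P ((φ.range.map Q.subtype).subtype.comp e.toMonoidHom) ∈ T
      rw [h1]
      exact h
    · have h1 := image_opposite_eq_iff.1 hT.2.2.2.2.2 _ h
      change graph _ ((Subgroup.subtype _).comp _) ∈ T
      convert h1
      ext a
      change _ ↔ (a.2, a.1) ∈ graph _ _
      constructor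
      · rintro ⟨v, rfl⟩
        refine ⟨e.symm v, Prod.ext ?_ rfl⟩
        change (φ (e.symm v) : S) = v
        rw [← he, e.apply_symm_apply]
      · rintro ⟨u, hu⟩
        obtain ⟨h2, h3⟩ := Prod.mk.inj hu
        refine ⟨e u, Prod.ext ?_ ((he u).trans h2)⟩
        change ((e.symm (e u) : P) : S) = a.1
        rw [e.symm_apply_apply]
        exact h3

theorem FusionSystem.system_ofSystem {T : Set (Subgroup (S × S))} (hT : T ∈ Sys S) :
    (FusionSystem.ofSystem hT).system = T := by
  ext L
  constructor
  · rintro ⟨P, φ, h, rfl⟩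
    exact h
  · intro hL
    obtain ⟨V, φ, -, rfl⟩ := hT.1 hL
    exact ⟨V, φ.codRestrict ⊤ fun _ => trivial, hL, rfl⟩


/-! ### The equivalence relation of a system and the element it defines -/

section

variable {S : Type u} [Group S] {T : Set (Subgroup (S × S))} {W : Type u} [Group W]

/-- Reflexivity of the relation `(α.prod β).range ∈ T` on homomorphisms `W →* S`. Opposites give
symmetry, `*` gives transitivity, and conjugate homomorphisms are related. -/
theorem prod_range_self_mem (hT : T ∈ Sys S) (α : W →* S) : (α.prod α).range ∈ T := by
  refine hT.2.2.1 _ hT.2.2.2.2.1 _ ?_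
  rintro _ ⟨w, rfl⟩
  exact mem_diagonal.2 rfl

theorem opposite_prod_range (α β : W →* S) :
    opposite (α.prod β).range = (β.prod α).range := by
  ext a
  constructor
  · rintro ⟨w, hw⟩
    exact ⟨w, congrArg Prod.swap hw⟩
  · rintro ⟨w, rfl⟩
    exact ⟨w, rfl⟩

theorem prod_range_mem_symm (hT : T ∈ Sys S) {α β : W →* S} (h : (α.prod β).range ∈ T) :
    (β.prod α).range ∈ T := by
  rw [← opposite_prod_range]
  exact image_opposite_eq_iff.1 hT.2.2.2.2.2 _ h

theorem prod_range_mem_trans (hT : T ∈ Sys S) {α β γ : W →* S} (h : (α.prod β).range ∈ T)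
    (h' : (β.prod γ).range ∈ T) : (α.prod γ).range ∈ T := by
  refine hT.2.2.1 _ (hT.2.2.2.1 _ h _ h') _ ?_
  rintro _ ⟨w, rfl⟩
  exact ⟨β w, ⟨w, rfl⟩, ⟨w, rfl⟩⟩

theorem prod_range_conj_mem (hT : T ∈ Sys S) (α : W →* S) (s : S) :
    (((MulAut.conj s).toMonoidHom.comp α).prod α).range ∈ T := by
  have h := hT.2.1 _ (prod_range_self_mem hT α) (s, 1)
  rw [prod_range_map_conj] at h
  convert h
  ext w
  simp

theorem map_conj_mem_iff (hT : T ∈ Sys S) {L : Subgroup (S × S)} {a : S × S} :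
    L.map (MulAut.conj a).toMonoidHom ∈ T ↔ L ∈ T := by
  refine ⟨fun h => ?_, fun h => hT.2.1 L h a⟩
  have h' := hT.2.1 _ h a⁻¹
  rwa [map_conj_inv_map_conj] at h'

/-- The number of homomorphisms linked to `α` by `T`. -/
def linkCount (T : Set (Subgroup (S × S))) (α : W →* S) : ℕ :=
  Nat.card {θ : W →* S // (θ.prod α).range ∈ T}

theorem linkCount_pos [Finite S] [Finite W] (hT : T ∈ Sys S) (α : W →* S) :
    0 < linkCount T α := by
  have : Finite (W →* S) := .of_injective _ DFunLike.coe_injective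
  have : Nonempty {θ : W →* S // (θ.prod α).range ∈ T} := ⟨⟨α, prod_range_self_mem hT α⟩⟩
  exact Nat.card_pos

theorem linkCount_congr (hT : T ∈ Sys S) {α β : W →* S} (h : (α.prod β).range ∈ T) :
    linkCount T α = linkCount T β :=
  Nat.card_congr (Equiv.subtypeEquivRight fun _ =>
    ⟨fun h' => prod_range_mem_trans hT h' h,
      fun h' => prod_range_mem_trans hT h' (prod_range_mem_symm hT h)⟩)

theorem prod_range_eq_graph (α : W →* S) (φ : α.range →* S) :
    ((φ.comp α.rangeRestrict).prod α).range = graph α.range φ := by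
  ext a
  rw [mem_graph]
  constructor
  · rintro ⟨w, rfl⟩
    exact ⟨⟨w, rfl⟩, rfl⟩
  · rintro ⟨h1, h2⟩
    obtain ⟨w, hw⟩ := id h1
    refine ⟨w, Prod.ext (Eq.trans ?_ h2) hw⟩
    exact congrArg φ (Subtype.ext hw)

/-- If `θ` is linked to `α`, then `θ(w)` is a function of `α(w)`, so `θ` is a morphism on the image
of `α` precomposed with `α`. -/
theorem linkCount_eq_card_hom (F : FusionSystem S) (α : W →* S) :
    linkCount F.system α = Nat.card (F.Hom α.range ⊤) := by
  refine (Nat.card_congr (Equiv.ofBijective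
    (fun φ : F.Hom α.range ⊤ => (⟨((⊤ : Subgroup S).subtype.comp φ.1).comp
      α.rangeRestrict, by
        rw [prod_range_eq_graph]
        exact F.mem_hom_iff.1 φ.2⟩ : {θ : W →* S // (θ.prod α).range ∈ F.system}))
    ⟨?_, ?_⟩)).symm
  · rintro ⟨φ, hφ⟩ ⟨ψ, hψ⟩ h
    refine Subtype.ext (MonoidHom.ext ?_)
    rintro ⟨_, w, rfl⟩
    exact Subtype.ext (DFunLike.congr_fun (congrArg Subtype.val h) w)
  · rintro ⟨θ, P, φ, hφ, h⟩
    obtain rfl : α.range = P := by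
      rw [← graph_map_snd P ((⊤ : Subgroup S).subtype.comp φ), ← h, MonoidHom.map_range,
        MonoidHom.snd_comp_prod]
    refine ⟨⟨φ, hφ⟩, Subtype.ext (MonoidHom.ext fun w => ?_)⟩
    have hw : (θ w, α w) ∈ graph α.range ((⊤ : Subgroup S).subtype.comp φ) := h ▸ ⟨w, rfl⟩
    exact (mem_graph.1 hw).2

/-- Members of `T` are twisted diagonals, so anything linked to `α ∘ e` kills the kernel of `e` and
descends. Hence class sizes do not depend on the parametrisation. -/
theorem linkCount_comp_of_surjective (hT : T ∈ Sys S) {W' : Type u} [Group W'] (e : W' →* W)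
    (he : Function.Surjective e) (α : W →* S) :
    linkCount T (α.comp e) = linkCount T α := by
  have hr : ∀ θ : W →* S, ((θ.comp e).prod (α.comp e)).range = (θ.prod α).range := by
    intro θ
    ext a
    constructor
    · rintro ⟨w, rfl⟩
      exact ⟨e w, rfl⟩
    · rintro ⟨w, rfl⟩
      obtain ⟨w, rfl⟩ := he w
      exact ⟨w, rfl⟩
  refine (Nat.card_congr (Equiv.ofBijective
    (fun θ : {θ : W →* S // (θ.prod α).range ∈ T} => (⟨θ.1.comp e, by
      rw [hr]
      exact θ.2⟩ : {θ : W' →* S // (θ.prod (α.comp e)).range ∈ T})) ⟨?_, ?_⟩)).symm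
  · rintro ⟨θ, _⟩ ⟨θ', _⟩ h
    exact Subtype.ext ((MonoidHom.cancel_right he).1 (congrArg Subtype.val h))
  · rintro ⟨θ, hθ⟩
    have hker : e.ker ≤ θ.ker := by
      intro w hw
      have hw' : e w = 1 := hw
      refine (mem_twistedDiagonals_iff.1 (hT.1 hθ) _ ⟨w, rfl⟩).2 ?_
      change α (e w) = 1
      rw [hw', map_one]
    have hc : (e.liftOfSurjective he ⟨θ, hker⟩).comp e = θ := by
      exact MonoidHom.liftOfRightInverse_comp _ _ _ _
    refine ⟨⟨e.liftOfSurjective he ⟨θ, hker⟩, ?_⟩, Subtype.ext hc⟩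
    rw [← hr, hc]
    exact hθ

theorem prod_range_projections (L : Subgroup (S × S)) :
    (((MonoidHom.fst S S).comp L.subtype).prod ((MonoidHom.snd S S).comp L.subtype)).range =
      L := by
  ext a
  constructor
  · rintro ⟨x, rfl⟩
    exact x.2
  · intro ha
    exact ⟨⟨a, ha⟩, rfl⟩

variable [Finite S]

/-- `ω` is bifree, with mark `|S|` divided by the number of homomorphisms linked to a member of
`T` at that member, and zero marks outside `T`. -/
def HasSystemMarks (T : Set (Subgroup (S × S))) (ω : QB S S) : Prop :=
  ω ∈ bifree S S ∧ ∀ L : Subgroup (S × S),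
    (L ∈ T → mark L ω =
      (Nat.card S : ℚ) / (linkCount T ((MonoidHom.fst S S).comp L.subtype) : ℚ)) ∧
    (L ∉ T → mark L ω = 0)

theorem isOmega_iff_hasSystemMarks (F : FusionSystem S) (ω : QB S S) :
    IsOmega F ω ↔ HasSystemMarks F.system ω := by
  refine and_congr_right fun _ => forall_congr' fun L => ?_
  have h : ((MonoidHom.fst S S).comp L.subtype).range = L.map (MonoidHom.fst S S) := by
    rw [← MonoidHom.map_range, Subgroup.range_subtype]
  rw [linkCount_eq_card_hom, h]

theorem HasSystemMarks.unique {ω ω' : QB S S} (h : HasSystemMarks T ω)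
    (h' : HasSystemMarks T ω') : ω = ω' := by
  refine ext_mark fun L => ?_
  by_cases hL : L ∈ T
  · rw [(h.2 L).1 hL, (h'.2 L).1 hL]
  · rw [(h.2 L).2 hL, (h'.2 L).2 hL]

theorem HasSystemMarks.pairMark_of_mem {ω : QB S S} (h : HasSystemMarks T ω) (hT : T ∈ Sys S)
    {α β : W →* S} (hαβ : (α.prod β).range ∈ T) :
    pairMark α β ω = (Nat.card S : ℚ) / (linkCount T α : ℚ) := by
  rw [pairMark, (h.2 _).1 hαβ, ← linkCount_comp_of_surjective hT (α.prod β).rangeRestrict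
    (α.prod β).rangeRestrict_surjective]
  rfl

theorem HasSystemMarks.pairMark_of_notMem {ω : QB S S} (h : HasSystemMarks T ω)
    {α β : W →* S} (hαβ : (α.prod β).range ∉ T) : pairMark α β ω = 0 :=
  (h.2 _).2 hαβ

theorem exists_hasSystemMarks (hT : T ∈ Sys S) : ∃ ω : QB S S, HasSystemMarks T ω := by
  classical
  obtain ⟨ω, hω, hm⟩ := exists_mark_eq T hT.2.2.1 hT.2.1
    (fun L => if L ∈ T then
      (Nat.card S : ℚ) / (linkCount T ((MonoidHom.fst S S).comp L.subtype) : ℚ) else 0)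
    (fun L a => by
      rw [map_conj_mem_iff hT]
      congr 3
      have h1 : linkCount T ((MonoidHom.fst S S).comp
          (L.map (MulAut.conj a).toMonoidHom).subtype) =
          linkCount T ((MulAut.conj a.1).toMonoidHom.comp
            ((MonoidHom.fst S S).comp L.subtype)) := by
        rw [← linkCount_comp_of_surjective hT ((MulAut.conj a).toMonoidHom.subgroupMap L)
          (MonoidHom.subgroupMap_surjective _ _)]
        rfl
      rw [h1]
      exact linkCount_congr hT (prod_range_conj_mem hT _ _))
    (fun L hL => by
      by_contra h
      exact hL (if_neg h))
  refine ⟨ω, ?_, fun L => ⟨fun hL => (hm L).trans (if_pos hL), fun hL => (hm L).trans (if_neg hL)⟩⟩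
  refine Submodule.span_mono ?_ hω
  rintro _ ⟨L, hL, rfl⟩
  exact ⟨L, hT.1 hL, rfl⟩

theorem HasSystemMarks.fix_eq {ω : QB S S} (h : HasSystemMarks T ω) (hT : T ∈ Sys S) :
    Fix ω = T := by
  ext L
  constructor
  · rintro ⟨-, hL⟩
    by_contra h'
    exact hL ((h.2 L).2 h')
  · intro hL
    refine ⟨hT.1 hL, ?_⟩
    rw [(h.2 L).1 hL]
    exact div_ne_zero (Nat.cast_ne_zero.2 Nat.card_pos.ne')
      (Nat.cast_ne_zero.2 (linkCount_pos hT _).ne')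

/-- If `α` and `γ` are linked, exactly the N members of their class contribute, each `(|S| / N)²`,
with total `|S| · |S| / N`. If they are not, no `θ` is linked to both. -/
theorem HasSystemMarks.dot_self {ω : QB S S} (h : HasSystemMarks T ω) (hT : T ∈ Sys S) :
    dot ω ω = ω := by
  classical
  refine ext_mark fun L => ?_
  rw [mark_eq_pairMark]
  generalize (MonoidHom.fst S S).comp L.subtype = α
  generalize (MonoidHom.snd S S).comp L.subtype = γ
  have : Finite (L →* S) := .of_injective _ DFunLike.coe_injective
  have := Fintype.ofFinite (L →* S)
  have hS : (Nat.card S : ℚ) ≠ 0 := Nat.cast_ne_zero.2 Nat.card_pos.ne'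
  have hd := pairMark_dot_of_mem_leftFree α γ ω (bifree_le_leftFree h.1)
  refine mul_left_cancel₀ hS (hd.trans ?_)
  by_cases hαγ : (α.prod γ).range ∈ T
  · have hc : (linkCount T α : ℚ) ≠ 0 := Nat.cast_ne_zero.2 (linkCount_pos hT α).ne'
    have key : ∀ θ : L →* S, pairMark α θ ω * pairMark θ γ ω =
        if (θ.prod α).range ∈ T then ((Nat.card S : ℚ) / (linkCount T α : ℚ)) ^ 2 else 0 := by
      intro θ
      split_ifs with hθ
      · rw [h.pairMark_of_mem hT (prod_range_mem_symm hT hθ),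
          h.pairMark_of_mem hT (prod_range_mem_trans hT hθ hαγ), linkCount_congr hT hθ, sq]
      · rw [h.pairMark_of_notMem fun h' => hθ (prod_range_mem_symm hT h'), zero_mul]
    have hcard : ((Finset.univ.filter fun θ : L →* S => (θ.prod α).range ∈ T).card : ℚ) =
        linkCount T α := by
      rw [linkCount, Nat.card_eq_fintype_card, Fintype.card_subtype]
    rw [Finset.sum_congr rfl fun θ _ => key θ, ← Finset.sum_filter, Finset.sum_const,
      nsmul_eq_mul, hcard, h.pairMark_of_mem hT hαγ]
    field_simp
  · rw [h.pairMark_of_notMem hαγ, mul_zero]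
    refine Finset.sum_eq_zero fun θ _ => ?_
    by_cases hθ : (α.prod θ).range ∈ T
    · rw [h.pairMark_of_notMem (α := θ) fun h' => hαγ (prod_range_mem_trans hT hθ h'), mul_zero]
    · rw [h.pairMark_of_notMem hθ, zero_mul]

theorem HasSystemMarks.mem_Idem {ω : QB S S} (h : HasSystemMarks T ω) (hT : T ∈ Sys S) :
    ω ∈ Idem S := by
  refine ⟨h.1, h.dot_self hT, (isRightFrobenius_iff (bifree_le_leftFree h.1)).2 ?_,
    (isLeftFrobenius_iff (bifree_le_rightFree h.1)).2 ?_, ?_, ?_⟩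
  · intro W _ _ α₁ α₂ γ
    -- Once `α₂` and `γ` are linked, `α₁` is linked to both or to neither, and the mark depends only
    -- on the class of its first argument.
    by_cases h2 : (α₂.prod γ).range ∈ T
    · congr 1
      by_cases h1 : (α₁.prod γ).range ∈ T
      · rw [h.pairMark_of_mem hT h1, h.pairMark_of_mem hT
          (prod_range_mem_trans hT h1 (prod_range_mem_symm hT h2))]
      · rw [h.pairMark_of_notMem h1,
          h.pairMark_of_notMem fun h' => h1 (prod_range_mem_trans hT h' h2)]
    · rw [h.pairMark_of_notMem h2, mul_zero, mul_zero]
  · intro W _ _ α γ₁ γ₂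
    rw [mul_comm]
    by_cases h2 : (α.prod γ₂).range ∈ T
    · congr 1
      by_cases h1 : (α.prod γ₁).range ∈ T
      · rw [h.pairMark_of_mem hT h1, h.pairMark_of_mem hT
          (prod_range_mem_trans hT (prod_range_mem_symm hT h2) h1), linkCount_congr hT h2]
      · rw [h.pairMark_of_notMem h1, h.pairMark_of_notMem (α := γ₂)
          fun h' => h1 (prod_range_mem_trans hT h2 h')]
    · rw [h.pairMark_of_notMem h2, zero_mul, zero_mul]
  · rw [h.fix_eq hT]
    exact hT.2.2.1
  · rw [h.fix_eq hT]
    exact hT.2.2.2.2.1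

/-! ### Elements of `Idem(S)` -/

variable {ω : QB S S}

theorem prod_range_mem_Fix_iff (hω : ω ∈ Idem S) {α β : W →* S} :
    (α.prod β).range ∈ Fix ω ↔ pairMark α β ω ≠ 0 :=
  ⟨fun h => h.2, fun h => ⟨mem_twistedDiagonals_of_mark_ne_zero hω.1 h, h⟩⟩

theorem pairMark_self_ne_zero (hω : ω ∈ Idem S) (α : W →* S) : pairMark α α ω ≠ 0 := by
  refine (prod_range_mem_Fix_iff hω).1 (hω.2.2.2.2.1 _ hω.2.2.2.2.2 _ ?_)
  rintro _ ⟨w, rfl⟩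
  exact mem_diagonal.2 rfl

variable [Finite W]

/-- The right Frobenius identity at `(γ, α, γ)`: m(γ, γ) m(α, γ) = m(γ, α) m(α, γ). -/
theorem pairMark_comm_of_ne_zero (hω : ω ∈ Idem S) {α γ : W →* S}
    (h : pairMark α γ ω ≠ 0) : pairMark γ α ω = pairMark γ γ ω :=
  (mul_right_cancel₀ h
    ((isRightFrobenius_iff (bifree_le_leftFree hω.1)).1 hω.2.2.1 W γ α γ)).symm

/-- The left Frobenius identity at `(α, γ, γ)`: m(α, γ)² = m(α, γ) m(γ, γ). -/
theorem pairMark_eq_right_of_ne_zero (hω : ω ∈ Idem S) {α γ : W →* S}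
    (h : pairMark α γ ω ≠ 0) : pairMark α γ ω = pairMark γ γ ω :=
  mul_left_cancel₀ h
    ((isLeftFrobenius_iff (bifree_le_rightFree hω.1)).1 hω.2.2.2.1 W α γ γ)

theorem pairMark_ne_zero_symm (hω : ω ∈ Idem S) {α γ : W →* S}
    (h : pairMark α γ ω ≠ 0) : pairMark γ α ω ≠ 0 := by
  rw [pairMark_comm_of_ne_zero hω h]
  exact pairMark_self_ne_zero hω γ

theorem pairMark_ne_zero_trans (hω : ω ∈ Idem S) {α β γ : W →* S}
    (h : pairMark α β ω ≠ 0) (h' : pairMark β γ ω ≠ 0) : pairMark α γ ω ≠ 0 := by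
  have := (isRightFrobenius_iff (bifree_le_leftFree hω.1)).1 hω.2.2.1 W α β γ
  rw [mul_left_inj' h'] at this
  rwa [this]

theorem Fix_mem_Sys (hω : ω ∈ Idem S) : Fix ω ∈ Sys S := by
  refine ⟨fun _ h => h.1, ?_, hω.2.2.2.2.1, ?_, hω.2.2.2.2.2, image_opposite_eq_iff.2 ?_⟩
  · intro L hL a
    refine ⟨map_conj_mem_twistedDiagonals_iff.2 hL.1, ?_⟩
    rw [mark_map_conj]
    exact hL.2
  · intro L hL M hM
    -- The triples `(g, h, k)` with `(g, h)` in `L` and `(h, k)` in `M` form one parameter group for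
    -- both links, so that transitivity applies; their outer coordinates make up `L * M`.
    let V : Subgroup (S × S × S) :=
      L.comap ((MonoidHom.fst S (S × S)).prod
        ((MonoidHom.fst S S).comp (MonoidHom.snd S (S × S)))) ⊓
      M.comap (MonoidHom.snd S (S × S))
    let α : V →* S := (MonoidHom.fst S (S × S)).comp V.subtype
    let β : V →* S := ((MonoidHom.fst S S).comp (MonoidHom.snd S (S × S))).comp V.subtype
    let γ : V →* S := ((MonoidHom.snd S S).comp (MonoidHom.snd S (S × S))).comp V.subtype
    have h1 : (α.prod β).range ∈ Fix ω := by
      refine hω.2.2.2.2.1 L hL _ ?_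
      rintro _ ⟨v, rfl⟩
      exact v.2.1
    have h2 : (β.prod γ).range ∈ Fix ω := by
      refine hω.2.2.2.2.1 M hM _ ?_
      rintro _ ⟨v, rfl⟩
      exact v.2.2
    have h3 : star L M = (α.prod γ).range := by
      ext a
      constructor
      · rintro ⟨h, hL, hM⟩
        exact ⟨⟨(a.1, h, a.2), hL, hM⟩, rfl⟩
      · rintro ⟨v, rfl⟩
        exact ⟨v.1.2.1, v.2⟩
    rw [h3, prod_range_mem_Fix_iff hω]
    exact pairMark_ne_zero_trans hω ((prod_range_mem_Fix_iff hω).1 h1)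
      ((prod_range_mem_Fix_iff hω).1 h2)
  · intro L hL
    rw [← prod_range_projections L] at hL ⊢
    rw [opposite_prod_range, prod_range_mem_Fix_iff hω]
    exact pairMark_ne_zero_symm hω ((prod_range_mem_Fix_iff hω).1 hL)

/-- Idempotency at `(α, α)`: every `θ` in the class of `α` contributes m(α, α)², giving |S| c = N c²
with c = m(α, α) nonzero. -/
theorem pairMark_self_eq (hω : ω ∈ Idem S) (α : W →* S) :
    pairMark α α ω = (Nat.card S : ℚ) / (linkCount (Fix ω) α : ℚ) := by
  classical
  have : Finite (W →* S) := .of_injective _ DFunLike.coe_injective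
  have := Fintype.ofFinite (W →* S)
  have hd := pairMark_dot_of_mem_leftFree α α ω (bifree_le_leftFree hω.1)
  have key : ∀ θ : W →* S, pairMark α θ ω * pairMark θ α ω =
      if (θ.prod α).range ∈ Fix ω then pairMark α α ω ^ 2 else 0 := by
    intro θ
    split_ifs with hθ
    · rw [prod_range_mem_Fix_iff hω] at hθ
      rw [pairMark_comm_of_ne_zero hω hθ, pairMark_eq_right_of_ne_zero hω hθ, sq]
    · rw [prod_range_mem_Fix_iff hω, not_not] at hθ
      rw [hθ, mul_zero]
  have hcard : ((Finset.univ.filter fun θ : W →* S => (θ.prod α).range ∈ Fix ω).card : ℚ) =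
      linkCount (Fix ω) α := by
    rw [linkCount, Nat.card_eq_fintype_card, Fintype.card_subtype]
  rw [hω.2.1, Finset.sum_congr rfl fun θ _ => key θ, ← Finset.sum_filter, Finset.sum_const,
    nsmul_eq_mul, hcard, sq, ← mul_assoc] at hd
  have hc : (linkCount (Fix ω) α : ℚ) ≠ 0 :=
    Nat.cast_ne_zero.2 (linkCount_pos (Fix_mem_Sys hω) α).ne'
  rw [eq_div_iff hc, mul_comm]
  exact (mul_right_cancel₀ (pairMark_self_ne_zero hω α) hd).symm

theorem hasSystemMarks_Fix (hω : ω ∈ Idem S) : HasSystemMarks (Fix ω) ω := by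
  refine ⟨hω.1, fun L => ⟨fun hL => ?_, fun hL => ?_⟩⟩
  · rw [← pairMark_self_eq hω, mark_eq_pairMark]
    have h := hL.2
    rw [mark_eq_pairMark] at h
    -- The chain is m(α, γ) = m(γ, γ) = m(γ, α) = m(α, α).
    rw [pairMark_eq_right_of_ne_zero hω h,
      ← pairMark_comm_of_ne_zero hω h,
      pairMark_eq_right_of_ne_zero hω (pairMark_ne_zero_symm hω h)]
  · by_contra h
    exact hL ⟨mem_twistedDiagonals_of_mark_ne_zero hω.1 h, h⟩

end

end DoubleBurnside
end

/-! ### The three bijections -/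

theorem theorem7p13 {p : ℕ} [Fact p.Prime] {S : Type*} [Group S] [Finite S]
    (hS : IsPGroup p S) :
    ∃ (f : DoubleBurnside.FusionSystem S → DoubleBurnside.Idem S)
      (g : DoubleBurnside.Idem S → DoubleBurnside.Sys S)
      (h : DoubleBurnside.FusionSystem S → DoubleBurnside.Sys S),
      -- `f(F)` is the one and only element `ω_F`
      (∀ (F : DoubleBurnside.FusionSystem S) (ω : DoubleBurnside.QB S S),
        DoubleBurnside.IsOmega F ω ↔ ω = f F) ∧
      (∀ ω : DoubleBurnside.Idem S,
        (g ω : Set (Subgroup (S × S))) = DoubleBurnside.Fix (ω : DoubleBurnside.QB S S)) ∧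
      (∀ F : DoubleBurnside.FusionSystem S, (h F : Set (Subgroup (S × S))) = F.system) ∧
      Function.Bijective f ∧ Function.Bijective g ∧ Function.Bijective h ∧
      g ∘ f = h ∧
      -- the inverse of `f` sends `ω` to the fusion system `F` with `S(F) = Fix(ω)`
      (∀ (F : DoubleBurnside.FusionSystem S) (ω : DoubleBurnside.Idem S),
        f F = ω ↔ F.system = DoubleBurnside.Fix (ω : DoubleBurnside.QB S S)) := by
  choose w hw using fun F : DoubleBurnside.FusionSystem S =>
    DoubleBurnside.exists_hasSystemMarks F.system_mem_Sys
  let f : DoubleBurnside.FusionSystem S → DoubleBurnside.Idem S := fun F =>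
    ⟨w F, (hw F).mem_Idem F.system_mem_Sys⟩
  let g : DoubleBurnside.Idem S → DoubleBurnside.Sys S := fun ω =>
    ⟨DoubleBurnside.Fix ω.1, DoubleBurnside.Fix_mem_Sys ω.2⟩
  let h : DoubleBurnside.FusionSystem S → DoubleBurnside.Sys S := fun F =>
    ⟨F.system, F.system_mem_Sys⟩
  -- The marks of `ω` are prescribed by `Fix ω` alone.
  have hg : Function.Injective g := by
    intro ω ω' he
    have he' : DoubleBurnside.Fix ω.1 = DoubleBurnside.Fix ω'.1 := congrArg Subtype.val he
    have h1 := DoubleBurnside.hasSystemMarks_Fix ω.2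
    rw [he'] at h1
    exact Subtype.ext (h1.unique (DoubleBurnside.hasSystemMarks_Fix ω'.2))
  have hh : Function.Bijective h :=
    ⟨fun F F' he => DoubleBurnside.FusionSystem.system_injective (congrArg Subtype.val he),
      fun T => ⟨DoubleBurnside.FusionSystem.ofSystem T.2,
        Subtype.ext (DoubleBurnside.FusionSystem.system_ofSystem T.2)⟩⟩
  have hgf : g ∘ f = h := funext fun F => Subtype.ext ((hw F).fix_eq F.system_mem_Sys)
  -- Surjectivity of `g` comes from that of `g ∘ f = h`; cancelling the bijection `g` then gives
  -- bijectivity of `f`.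
  have hgb : Function.Bijective g := ⟨hg, Function.Surjective.of_comp (hgf ▸ hh.2)⟩
  have hfb : Function.Bijective f := (Function.Bijective.of_comp_iff' hgb f).1 (hgf ▸ hh)
  refine ⟨f, g, h, fun F ω => ?_, fun _ => rfl, fun _ => rfl, hfb, hgb, hh, hgf, fun F ω => ?_⟩
  · rw [DoubleBurnside.isOmega_iff_hasSystemMarks]
    refine ⟨fun hω => hω.unique (hw F), ?_⟩
    rintro rfl
    exact hw F
  · rw [← hg.eq_iff, show g (f F) = h F from congrFun hgf F]
    exact Subtype.ext_iff
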